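/- Let $n,p,m\in\mathbb N$, $p\le n$. Let $\lambda_0\in L^\infty(0,1;\mathbb R)$ with $\lambda_0\ge\epsilon>0$ a.e., $M\in L^\infty(0,1;\mathbb C^{n\times n})$, $K,L\in\mathbb C^{n\times n}$ with $K$ invertible, and $K_y,L_y\in\mathbb C^{m\times n}$. Let $P$ be the continuous solution on $[0,1]$ of $P'=\lambda_0^{-1}MP$, $P(0)=I$ (i.e. of the corresponding integral equation), let $p(1):=\int_0^1\lambda_0(\eta)^{-1}\,d\eta$, and let $\left[\begin{smallmatrix}0\\ I\end{smallmatrix}\right]\in\mathbb C^{n\times p}$ be the matrix whose last $p$ rows form the identity and whose other rows vanish. Put $$A_d=-K^{-1}LP(1),\quad B_d=-K^{-1}\left[\begin{smallmatrix}0\\ I\end{smallmatrix}\right],\quad C_d=(K_yK^{-1}L-L_y)P(1),\quad D_d=K_yK^{-1}\left[\begin{smallmatrix}0\\ I\end{smallmatrix}\right].$$ Let $X=L^2(0,1;\mathbb C^n)$. For $z_0\in X$ and an input $u$ with values in $\mathbb C^p$ consider $$\frac{\partial z}{\partial t}(\zeta,t)=-\frac{\partial}{\partial\zeta}\big(\lambda_0(\zeta)z(\zeta,t)\big),\qquad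 z(\zeta,0)=z_0(\zeta),$$ $$\left[\begin{smallmatrix}0\\ I\end{smallmatrix}\right]u(t)=-\lambda_0(0)Kz(0,t)-\lambda_0(1)LP(1)z(1,t),\qquad y(t)=-\lambda_0(0)K_yz(0,t)-\lambda_0(1)L_yP(1)z(1,t),$$ and the cost $p(1)^{-1}J(z_0,u)$, where $J(z_0,u)=\int_0^\infty\big(\|y(t)\|^2+\|u(t)\|^2\big)\,dt\in[0,\infty]$. Solutions are mild solutions $z\in C([0,\infty);X)$; $\lambda_0(0)z(0,\cdot)$ and $\lambda_0(1)z(1,\cdot)$ denote the boundary values of $\lambda_0 z$, which are functions in $L^2_{\rm loc}([0,\infty);\mathbb C^n)$; equation and boundary values are understood after integration in time: for every $t\ge0$, $\lambda_0\int_0^tz(\cdot,s)\,ds\in H^1(0,1;\mathbb C^n)$, $z(\cdot,t)-z_0=-\partial_\zeta\big(\lambda_0\int_0^tz(\cdot,s)\,ds\big)$, and the boundary values of $\lambda_0\int_0^t z(\cdot,s)\,ds$ at $\zeta=0,1$ are the integrals over $(0,t)$ of the boundary values of $\lambda_0z$. Assume that the control algebraic Riccati equation (CARE) $$A_d^*\Pi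 A_d-\Pi+C_d^*C_d=(C_d^*D_d+A_d^*\Pi B_d)(I+D_d^*D_d+B_d^*\Pi B_d)^{-1}(D_d^*C_d+B_d^*\Pi A_d)$$ and the filter algebraic Riccati equation (FARE) $$A_d\tilde\Pi A_d^*-\tilde\Pi+B_dB_d^*=(B_dD_d^*+A_d\tilde\Pi C_d^*)(I+D_dD_d^*+C_d\tilde\Pi C_d^*)^{-1}(D_dB_d^*+C_d\tilde\Pi A_d^*)$$ have nonnegative self-adjoint solutions $\Pi,\tilde\Pi\in\mathbb C^{n\times n}$, and that $A_\Pi:=A_d-B_d(I+D_d^*D_d+B_d^*\Pi B_d)^{-1}(D_d^*C_d+B_d^*\Pi A_d)$ has spectral radius $r(A_\Pi)<1$. Put $F_d:=-(I+D_d^*D_d+B_d^*\Pi B_d)^{-1}(D_d^*C_d+B_d^*\Pi A_d)$. Then: 1. For all $z_0\in X$ and $u\in L^2_{\rm loc}([0,\infty);\mathbb C^p)$ the system has exactly one solution $z$ with output $y$, so that $J(z_0,u)$ is well defined. 2. For every $z_0\in X$ the closed-loop system $$\frac{\partial z^{\rm opt}}{\partial t}(\zeta,t)=-\frac{\partial}{\partial\zeta}\big(\lambda_0(\zeta)z^{\rm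 opt}(\zeta,t)\big),\quad z^{\rm opt}(\zeta,0)=z_0(\zeta),\quad \lambda_0(0)z^{\rm opt}(0,t)=(A_d+B_dF_d)\lambda_0(1)z^{\rm opt}(1,t)$$ has exactly one solution $z^{\rm opt}$. The control $u^{\rm opt}(t)=\lambda_0(1)F_dz^{\rm opt}(1,t)$ lies in $L^2(0,\infty;\mathbb C^p)$, generates the trajectory $z^{\rm opt}$, minimizes $p(1)^{-1}J(z_0,\cdot)$ over $L^2(0,\infty;\mathbb C^p)$, and is (up to null sets) the only minimizer. 3. The closed-loop system is exponentially stable: there are $C,\omega>0$ such that $\|z^{\rm opt}(\cdot,t)\|_X\le Ce^{-\omega t}\|z_0\|_X$ for all $t\ge0$ and all $z_0\in X$. -/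

import Mathlib

open MeasureTheory Set Matrix
open scoped ENNReal ComplexOrder

noncomputable section

/-- Solvability of the linear Carathéodory equation `P(ζ) = v₀ + ∫₀^ζ G(s) P(s) ds` on `[0,1]`,
for an essentially bounded `G`. -/
theorem exists_volterra {V : Type*} [NormedAddCommGroup V] [NormedSpace ℝ V] [CompleteSpace V]
    (G : ℝ → V →L[ℝ] V) (hG : AEStronglyMeasurable G (volume.restrict (Ioo (0 : ℝ) 1)))
    (c : ℝ) (hc : ∀ᵐ s ∂(volume.restrict (Ioo (0 : ℝ) 1)), ‖G s‖ ≤ c) (v₀ : V) :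
    ∃ P : ℝ → V, Continuous P ∧
      ∀ ζ ∈ Icc (0 : ℝ) 1, IntervalIntegrable (fun s => G s (P s)) volume 0 ζ ∧
        P ζ = v₀ + ∫ s in (0 : ℝ)..ζ, G s (P s) := by
  have hμ : (volume.restrict (Ioo (0 : ℝ) 1)) = volume.restrict (Ioc (0 : ℝ) 1) :=
    restrict_Ioo_eq_restrict_Ioc
  rw [hμ] at hG hc
  have hc' : ∀ᵐ s ∂(volume.restrict (Ioc (0 : ℝ) 1)), ‖G s‖ ≤ |c| :=
    hc.mono fun s hs => hs.trans (le_abs_self c)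
  set d : ℝ := |c| with hd
  have hd0 : 0 ≤ d := abs_nonneg c
  have hint : ∀ X : ℝ → V, Continuous X → IntegrableOn (fun s => G s (X s)) (Ioc (0 : ℝ) 1) := by
    intro X hX
    obtain ⟨b, hb⟩ := (isCompact_Icc (a := (0 : ℝ)) (b := 1)).exists_bound_of_continuousOn
      hX.continuousOn
    refine Integrable.of_bound (C := d * b) ?_ ?_
    · exact (ContinuousLinearMap.apply ℝ V).flip.aestronglyMeasurable_comp₂ hG
        hX.aestronglyMeasurable
    · filter_upwards [hc', ae_restrict_mem measurableSet_Ioc] with s h1 h2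
      calc ‖G s (X s)‖ ≤ ‖G s‖ * ‖X s‖ := (G s).le_opNorm _
        _ ≤ d * b := mul_le_mul h1 (hb s ⟨h2.1.le, h2.2⟩) (norm_nonneg _) hd0
  have hii : ∀ X : ℝ → V, Continuous X → ∀ ζ ∈ Icc (0 : ℝ) 1,
      IntervalIntegrable (fun s => G s (X s)) volume 0 ζ := by
    intro X hX ζ hζ
    rw [intervalIntegrable_iff_integrableOn_Ioc_of_le hζ.1]
    exact (hint X hX).mono_set (Ioc_subset_Ioc_right hζ.2)
  let E : C(Icc (0 : ℝ) 1, V) → ℝ → V := fun X s => X (projIcc 0 1 zero_le_one s)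
  have hE : ∀ X, Continuous (E X) := fun X => X.continuous.comp continuous_projIcc
  let T : C(Icc (0 : ℝ) 1, V) → C(Icc (0 : ℝ) 1, V) := fun X =>
    ⟨fun ζ => v₀ + ∫ s in (0 : ℝ)..ζ, G s (E X s), by
      refine continuous_const.add ?_
      have h := intervalIntegral.continuousOn_primitive_interval' (a := (0 : ℝ))
        (hii (E X) (hE X) 1 ⟨zero_le_one, le_rfl⟩) (by simp)
      rw [uIcc_of_le zero_le_one] at h
      exact continuousOn_iff_continuous_domRestrict.1 h⟩
  have hT : ∀ X ζ, T X ζ = v₀ + ∫ s in (0 : ℝ)..ζ, G s (E X s) := fun X ζ => rfl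
  have key : ∀ (k : ℕ) (X Y : C(Icc (0 : ℝ) 1, V)) (ζ : Icc (0 : ℝ) 1),
      ‖(T^[k] X) ζ - (T^[k] Y) ζ‖ ≤ d ^ k * (ζ : ℝ) ^ k / k.factorial * dist X Y := by
    intro k
    induction k with
    | zero =>
      intro X Y ζ
      simpa [dist_eq_norm] using ContinuousMap.dist_apply_le_dist (f := X) (g := Y) ζ
    | succ k ih =>
      intro X Y ζ
      rw [Function.iterate_succ_apply', Function.iterate_succ_apply', hT, hT,
        add_sub_add_left_eq_sub, ← intervalIntegral.integral_sub (hii _ (hE _) _ ζ.2)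
          (hii _ (hE _) _ ζ.2)]
      have hc2 : ∀ᵐ s, s ∈ Ioc (0 : ℝ) 1 → ‖G s‖ ≤ d :=
        (ae_restrict_iff' measurableSet_Ioc).1 hc'
      calc ‖∫ s in (0 : ℝ)..ζ, (G s (E (T^[k] X) s) - G s (E (T^[k] Y) s))‖
          ≤ ∫ s in (0 : ℝ)..ζ, d * (d ^ k * s ^ k / k.factorial * dist X Y) := by
            refine intervalIntegral.norm_integral_le_of_norm_le ζ.2.1 ?_
              (Continuous.intervalIntegrable (by fun_prop) _ _)
            filter_upwards [hc2] with s hs hsm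
            have hs1 : s ∈ Icc (0 : ℝ) 1 := ⟨hsm.1.le, hsm.2.trans ζ.2.2⟩
            rw [← map_sub]
            refine ((G s).le_opNorm _).trans ?_
            refine mul_le_mul (hs ⟨hsm.1, hs1.2⟩) ?_ (norm_nonneg _) hd0
            have := ih X Y ⟨s, hs1⟩
            simpa [E, projIcc_of_mem zero_le_one hs1] using this
        _ = d ^ (k + 1) * (ζ : ℝ) ^ (k + 1) / (k + 1).factorial * dist X Y := by
            rw [intervalIntegral.integral_const_mul, intervalIntegral.integral_mul_const,
              intervalIntegral.integral_div, intervalIntegral.integral_const_mul, integral_pow,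
              Nat.factorial_succ]
            push_cast
            have h1 : (k.factorial : ℝ) ≠ 0 := by positivity
            have h2 : (k : ℝ) + 1 ≠ 0 := by positivity
            field_simp
            ring
  obtain ⟨k, hk⟩ := (FloorSemiring.tendsto_pow_div_factorial_atTop d
    |>.eventually (gt_mem_nhds zero_lt_one)).exists
  have hcon : ContractingWith (⟨d ^ k / k.factorial, div_nonneg (pow_nonneg hd0 _) (Nat.cast_nonneg _)⟩ : NNReal) (T^[k]) := by
    refine ⟨hk, LipschitzWith.of_dist_le_mul fun X Y => ?_⟩
    refine (ContinuousMap.dist_le (mul_nonneg (div_nonneg (pow_nonneg hd0 _) (Nat.cast_nonneg _))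
      dist_nonneg)).2 fun ζ => ?_
    rw [dist_eq_norm]
    refine (key k X Y ζ).trans ?_
    refine mul_le_mul_of_nonneg_right ?_ dist_nonneg
    refine div_le_div_of_nonneg_right ?_ (by positivity)
    exact mul_le_of_le_one_right (by positivity) (pow_le_one₀ ζ.2.1 ζ.2.2)
  have hfix := hcon.isFixedPt_fixedPoint_iterate
  set X := hcon.fixedPoint
  refine ⟨E X, hE X, fun ζ hζ => ⟨hii (E X) (hE X) ζ hζ, ?_⟩⟩
  have : T X = X := hfix
  calc E X ζ = X ⟨ζ, hζ⟩ := by simp [E, projIcc_of_mem zero_le_one hζ]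
    _ = T X ⟨ζ, hζ⟩ := by rw [this]
    _ = _ := rfl

/-- Lebesgue measure on the spatial domain `(0,1)`. -/
abbrev spaceMeasure : Measure ℝ := volume.restrict (Ioo (0 : ℝ) 1)

/-- The state space `X = L²(0,1;ℂⁿ)`. -/
abbrev StateSpace (n : ℕ) : Type := Lp (EuclideanSpace ℂ (Fin n)) 2 spaceMeasure

/-- `w ∈ L²_loc([0,∞);ℂᵏ)`, i.e. `w ∈ L²(0,T;ℂᵏ)` for every `T`. -/
def L2Loc {k : ℕ} (w : ℝ → EuclideanSpace ℂ (Fin k)) : Prop :=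
  ∀ T : ℝ, MemLp w 2 (volume.restrict (Ioc 0 T))

/-- The data of a boundary controlled and boundary observed network of waves
`∂ₜ z̃ = -∂_ζ (λ₀ z̃) + M z̃`,
`[0; I] u = -λ₀(0) K z̃(0,·) - λ₀(1) L z̃(1,·)`, `y = -λ₀(0) K_y z̃(0,·) - λ₀(1) L_y z̃(1,·)`,
with `λ₀ ∈ L^∞(0,1)` bounded below by a positive constant, `M` essentially bounded and
`K` invertible. -/
structure WaveNetwork (n p m : ℕ) where
  /-- the transport speed `λ₀` -/
  lam : ℝ → ℝ
  /-- the zero-order term -/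
  M : ℝ → Matrix (Fin n) (Fin n) ℂ
  /-- boundary matrices of the input -/
  K : Matrix (Fin n) (Fin n) ℂ
  L : Matrix (Fin n) (Fin n) ℂ
  /-- boundary matrices of the output -/
  Ky : Matrix (Fin m) (Fin n) ℂ
  Ly : Matrix (Fin m) (Fin n) ℂ
  p_le_n : p ≤ n
  lam_memLp : MemLp lam ∞ spaceMeasure
  lam_pos : ∃ ε : ℝ, 0 < ε ∧ ∀ᵐ ζ ∂spaceMeasure, ε ≤ lam ζ
  M_memLp : ∀ i j, MemLp (fun ζ => M ζ i j) ∞ spaceMeasure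
  K_isUnit : IsUnit K

/-- The `n × p` block matrix `[0; I]` with zero block on top and the `p × p` identity below. -/
def inputBlock (n p : ℕ) : Matrix (Fin n) (Fin p) ℂ :=
  fun i j => if (i : ℕ) + p = (j : ℕ) + n then 1 else 0

/-- `λ₀ x ∈ H¹(0,1;ℂⁿ)` with `(λ₀ x)' = v ∈ L²`, `(λ₀ x)(0) = a` and `(λ₀ x)(1) = b`: the function
`λ₀ x` has the absolutely continuous representative `ζ ↦ a + ∫₀^ζ v`. -/
def HasDerivAndTraces {n : ℕ} (lam : ℝ → ℝ) (x v : StateSpace n)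
    (a b : EuclideanSpace ℂ (Fin n)) : Prop :=
  (∀ᵐ ζ ∂spaceMeasure, lam ζ • x ζ = a + ∫ s in (0 : ℝ)..ζ, v s) ∧
    b = a + ∫ s in (0 : ℝ)..1, v s

/-- `z ∈ C([0,∞);X)` is a mild solution of `∂ₜ z = -∂_ζ (λ₀ z)`, `z(0) = z₀`, whose boundary values
`(λ₀ z)(0,·)` and `(λ₀ z)(1,·)` are the functions `w₀, w₁ ∈ L²_loc`. As usual for mild solutions,
the equation and the boundary traces are read after integration in time: for all `t ≥ 0`,
`λ₀ ∫₀ᵗ z(s) ds ∈ H¹`, `z(t) - z₀ = -∂_ζ (λ₀ ∫₀ᵗ z(s) ds)`, and the boundary values of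
`λ₀ ∫₀ᵗ z(s) ds` are `∫₀ᵗ w₀` and `∫₀ᵗ w₁`. -/
structure IsTransportSolution {n : ℕ} (lam : ℝ → ℝ) (z₀ : StateSpace n) (z : ℝ → StateSpace n)
    (w₀ w₁ : ℝ → EuclideanSpace ℂ (Fin n)) : Prop where
  continuousOn : ContinuousOn z (Ici 0)
  init : z 0 = z₀
  trace_zero : L2Loc w₀
  trace_one : L2Loc w₁
  equation : ∀ t : ℝ, 0 ≤ t →
    HasDerivAndTraces lam (∫ s in (0 : ℝ)..t, z s) (z₀ - z t)
      (∫ s in (0 : ℝ)..t, w₀ s) (∫ s in (0 : ℝ)..t, w₁ s)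

section Riccati

variable {n p m : ℕ}

/-- `Π` is a nonnegative self-adjoint solution of the control algebraic Riccati equation. -/
def IsCARESolution (A : Matrix (Fin n) (Fin n) ℂ) (B : Matrix (Fin n) (Fin p) ℂ)
    (C : Matrix (Fin m) (Fin n) ℂ) (D : Matrix (Fin m) (Fin p) ℂ)
    (X : Matrix (Fin n) (Fin n) ℂ) : Prop :=
  X.PosSemidef ∧
    Aᴴ * X * A - X + Cᴴ * C =
      (Cᴴ * D + Aᴴ * X * B) * (1 + Dᴴ * D + Bᴴ * X * B)⁻¹ * (Dᴴ * C + Bᴴ * X * A)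

/-- `Π̃` is a nonnegative self-adjoint solution of the filter algebraic Riccati equation. -/
def IsFARESolution (A : Matrix (Fin n) (Fin n) ℂ) (B : Matrix (Fin n) (Fin p) ℂ)
    (C : Matrix (Fin m) (Fin n) ℂ) (D : Matrix (Fin m) (Fin p) ℂ)
    (X : Matrix (Fin n) (Fin n) ℂ) : Prop :=
  X.PosSemidef ∧
    A * X * Aᴴ - X + B * Bᴴ =
      (B * Dᴴ + A * X * Cᴴ) * (1 + D * Dᴴ + C * X * Cᴴ)⁻¹ * (D * Bᴴ + C * X * Aᴴ)

end Riccati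

namespace WaveNetwork

variable {n p m : ℕ}

/-- Combinations of constant vectors with `L^∞` coefficients are in `L^∞`. -/
theorem memLp_sum_smul {W : Type*} [NormedAddCommGroup W] [NormedSpace ℂ W]
    (a : Fin n → Fin n → ℝ → ℂ) (N : Fin n → Fin n → W)
    (ha : ∀ i k, MemLp (a i k) ∞ spaceMeasure) :
    MemLp (fun s => ∑ i, ∑ k, a i k s • N i k) ∞ spaceMeasure := by
  refine memLp_finsetSum _ fun i _ => memLp_finsetSum _ fun k _ => ?_
  exact ((ContinuousLinearMap.id ℂ ℂ).smulRight (N i k)).comp_memLp' (ha i k)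

/-- Existence of the solution of `P' = λ₀⁻¹ M P`, `P(0) = I` on `[0,1]`. -/
theorem exists_fundamentalMatrix (S : WaveNetwork n p m) :
    ∃ P : ℝ → Matrix (Fin n) (Fin n) ℂ, (∀ i j, Continuous fun ζ => P ζ i j) ∧
      ∀ ζ ∈ Icc (0 : ℝ) 1, ∀ i j,
        P ζ i j = (1 : Matrix (Fin n) (Fin n) ℂ) i j
          + ∫ s in (0 : ℝ)..ζ, ((S.lam s)⁻¹ : ℂ) * (S.M s * P s) i j := by
  obtain ⟨ε, hε, hlow⟩ := S.lam_pos
  have hinv : MemLp (fun s => ((S.lam s)⁻¹ : ℂ)) ∞ spaceMeasure := by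
    refine memLp_top_of_bound
      (Complex.measurable_ofReal.comp_aemeasurable
        S.lam_memLp.1.aemeasurable).inv.aestronglyMeasurable ε⁻¹ ?_
    filter_upwards [hlow] with s hs
    rw [norm_inv, Complex.norm_real, Real.norm_of_nonneg (hε.le.trans hs)]
    exact inv_anti₀ hε hs
  let N : Fin n → Fin n → (Fin n → Fin n → ℂ) →L[ℝ] (Fin n → Fin n → ℂ) := fun i k =>
    (ContinuousLinearMap.single ℝ (fun _ => Fin n → ℂ) i).comp
      (ContinuousLinearMap.proj (R := ℝ) (φ := fun _ : Fin n => Fin n → ℂ) k)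
  let a : Fin n → Fin n → ℝ → ℂ := fun i k s => ((S.lam s)⁻¹ : ℂ) * S.M s i k
  have ha : ∀ i k, MemLp (a i k) ∞ spaceMeasure := fun i k =>
    MemLp.mul (p := ∞) (q := ∞) (r := ∞) (S.M_memLp i k) hinv
  let G : ℝ → (Fin n → Fin n → ℂ) →L[ℝ] (Fin n → Fin n → ℂ) := fun s =>
    ∑ i, ∑ k, a i k s • N i k
  have hG : MemLp G ∞ spaceMeasure := memLp_sum_smul a N ha
  have hGapp : ∀ s X i j, G s X i j = ((S.lam s)⁻¹ : ℂ) * (S.M s * Matrix.of X) i j := by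
    intro s X i j
    have h : G s X = ∑ i, ∑ k, a i k s • N i k X := by
      simp [G, _root_.sum_apply]
    rw [h, Finset.sum_apply, Finset.sum_apply, Finset.sum_eq_single i]
    · simp [N, a, Matrix.mul_apply, Finset.mul_sum, mul_assoc]
    · intro b _ hb
      simp [N, Finset.sum_apply, Pi.single_eq_of_ne hb.symm]
    · simp
  obtain ⟨c, hc⟩ : ∃ c : ℝ, ∀ᵐ s ∂spaceMeasure, ‖G s‖ ≤ c :=
    ⟨(eLpNorm G ∞ spaceMeasure).toReal, by
      filter_upwards [ae_le_eLpNormEssSup (f := G) (μ := spaceMeasure)] with s hs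
      rw [← toReal_enorm]
      exact ENNReal.toReal_mono hG.2.ne (by simpa using hs)⟩
  obtain ⟨P, hP, hPe⟩ := exists_volterra G hG.1 c hc (fun i j => (1 : Matrix (Fin n) (Fin n) ℂ) i j)
  refine ⟨fun ζ => Matrix.of (P ζ), fun i j => by simp only [Matrix.of_apply]; fun_prop, ?_⟩
  intro ζ hζ i j
  obtain ⟨hPi, hPζ⟩ := hPe ζ hζ
  let ev : (Fin n → Fin n → ℂ) →L[ℝ] ℂ :=
    (ContinuousLinearMap.proj (R := ℝ) (φ := fun _ : Fin n => ℂ) j).comp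
      (ContinuousLinearMap.proj (R := ℝ) (φ := fun _ : Fin n => Fin n → ℂ) i)
  have h := ev.intervalIntegral_comp_comm hPi
  have h2 := congrArg ev hPζ
  rw [map_add, ← h] at h2
  simpa [ev, hGapp] using h2

/-- The fundamental matrix `P` on `[0,1]`: the continuous solution of `P' = λ₀⁻¹ M P`, `P(0) = I`
(in the Carathéodory sense). -/
def fundamentalMatrix (S : WaveNetwork n p m) : ℝ → Matrix (Fin n) (Fin n) ℂ :=
  S.exists_fundamentalMatrix.choose

/-- `A_d = -K⁻¹ L P(1)` -/
def Ad (S : WaveNetwork n p m) : Matrix (Fin n) (Fin n) ℂ :=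
  -(S.K⁻¹ * S.L * S.fundamentalMatrix 1)

/-- `B_d = -K⁻¹ [0; I]` -/
def Bd (S : WaveNetwork n p m) : Matrix (Fin n) (Fin p) ℂ :=
  -(S.K⁻¹ * inputBlock n p)

/-- `C_d = (K_y K⁻¹ L - L_y) P(1)` -/
def Cd (S : WaveNetwork n p m) : Matrix (Fin m) (Fin n) ℂ :=
  (S.Ky * S.K⁻¹ * S.L - S.Ly) * S.fundamentalMatrix 1

/-- `D_d = K_y K⁻¹ [0; I]` -/
def Dd (S : WaveNetwork n p m) : Matrix (Fin m) (Fin p) ℂ :=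
  S.Ky * S.K⁻¹ * inputBlock n p

/-- `F_d = -(I + D_d* D_d + B_d* Π B_d)⁻¹ (D_d* C_d + B_d* Π A_d)` -/
def Fd (S : WaveNetwork n p m) (X : Matrix (Fin n) (Fin n) ℂ) : Matrix (Fin p) (Fin n) ℂ :=
  -((1 + S.Ddᴴ * S.Dd + S.Bdᴴ * X * S.Bd)⁻¹ * (S.Ddᴴ * S.Cd + S.Bdᴴ * X * S.Ad))

/-- `A_Π = A_d - B_d (I + D_d* D_d + B_d* Π B_d)⁻¹ (D_d* C_d + B_d* Π A_d)` -/
def APi (S : WaveNetwork n p m) (X : Matrix (Fin n) (Fin n) ℂ) : Matrix (Fin n) (Fin n) ℂ :=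
  S.Ad - S.Bd * (1 + S.Ddᴴ * S.Dd + S.Bdᴴ * X * S.Bd)⁻¹ * (S.Ddᴴ * S.Cd + S.Bdᴴ * X * S.Ad)

/-- `(z, y)` are the state and the output, for the initial state `z₀` and the input `u`, of
`∂ₜ z = -∂_ζ (λ₀ z)`, `[0; I] u = -K (λ₀ z)(0,·) - L P(1) (λ₀ z)(1,·)`,
`y = -K_y (λ₀ z)(0,·) - L_y P(1) (λ₀ z)(1,·)`,
with boundary values `w₀ = (λ₀ z)(0,·)` and `w₁ = (λ₀ z)(1,·)`. -/
structure IsSolution (S : WaveNetwork n p m) (z₀ : StateSpace n)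
    (u : ℝ → EuclideanSpace ℂ (Fin p)) (z : ℝ → StateSpace n)
    (w₀ w₁ : ℝ → EuclideanSpace ℂ (Fin n)) (y : ℝ → EuclideanSpace ℂ (Fin m)) : Prop where
  transport : IsTransportSolution S.lam z₀ z w₀ w₁
  input : ∀ᵐ t ∂(volume.restrict (Ioi (0 : ℝ))),
    (inputBlock n p).toEuclideanLin (u t) =
      -(S.K.toEuclideanLin (w₀ t)) - (S.L * S.fundamentalMatrix 1).toEuclideanLin (w₁ t)
  output : ∀ᵐ t ∂(volume.restrict (Ioi (0 : ℝ))),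
    y t = -(S.Ky.toEuclideanLin (w₀ t)) - (S.Ly * S.fundamentalMatrix 1).toEuclideanLin (w₁ t)

/-- The autonomous closed-loop system `∂ₜ z = -∂_ζ (λ₀ z)`, `z(0) = z₀`,
`(λ₀ z)(0,·) = (A_d + B_d F) (λ₀ z)(1,·)`. -/
structure IsClosedLoopSolution (S : WaveNetwork n p m) (F : Matrix (Fin p) (Fin n) ℂ)
    (z₀ : StateSpace n) (z : ℝ → StateSpace n) (w₀ w₁ : ℝ → EuclideanSpace ℂ (Fin n)) : Prop where
  transport : IsTransportSolution S.lam z₀ z w₀ w₁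
  boundary : ∀ᵐ t ∂(volume.restrict (Ioi (0 : ℝ))),
    w₀ t = (S.Ad + S.Bd * F).toEuclideanLin (w₁ t)

/-- `y` is the output produced by the initial state `z₀` and the input `u`. -/
def IsOutput (S : WaveNetwork n p m) (z₀ : StateSpace n) (u : ℝ → EuclideanSpace ℂ (Fin p))
    (y : ℝ → EuclideanSpace ℂ (Fin m)) : Prop :=
  ∃ z w₀ w₁, S.IsSolution z₀ u z w₀ w₁ y

/-- The travel time `p(1) = ∫₀¹ λ₀⁻¹`. -/
def travelTime (S : WaveNetwork n p m) : ℝ := ∫ η in (0 : ℝ)..1, (S.lam η)⁻¹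

/-- The normalized cost `p(1)⁻¹ ∫₀^∞ (‖y‖² + ‖u‖²) dt`, possibly infinite. -/
def cost (S : WaveNetwork n p m) (u : ℝ → EuclideanSpace ℂ (Fin p))
    (y : ℝ → EuclideanSpace ℂ (Fin m)) : ℝ≥0∞ :=
  ENNReal.ofReal S.travelTime⁻¹ * ∫⁻ t in Ioi (0 : ℝ), (‖y t‖ₑ ^ 2 + ‖u t‖ₑ ^ 2)

/-- `u ∈ L²(0,∞;ℂᵖ)` minimizes the cost over all inputs in `L²(0,∞;ℂᵖ)`, for the initial
state `z₀`. -/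
def IsOptimalControl (S : WaveNetwork n p m) (z₀ : StateSpace n)
    (u : ℝ → EuclideanSpace ℂ (Fin p)) : Prop :=
  MemLp u 2 (volume.restrict (Ioi (0 : ℝ))) ∧
    ∃ y, S.IsOutput z₀ u y ∧
      ∀ v, MemLp v 2 (volume.restrict (Ioi (0 : ℝ))) →
        ∀ y', S.IsOutput z₀ v y' → S.cost u y ≤ S.cost v y'

end WaveNetwork

end

/-!
The proof reduces the network to a family of finite-dimensional linear quadratic problems.

*Transport is a delay.* Let `φ(ζ) = ∫₀^ζ λ₀⁻¹` be the travel time and `τ = φ(1)`. A function `f` on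
`(-τ, ∞)`, which extends the flux `λ₀ z₀` carried by the initial state (`Slowness.history`) by the
inflow, gives the travelling wave `λ₀ z(ζ, t) = f(t - φ(ζ))`. It is a mild solution with traces
`f` and `f(· - τ)` (`Slowness.isTransportSolution_state`; the change of variables is
`Slowness.map_phi`), and there is no other: for vanishing data, `x = ∫₀ᵗ z` satisfies
`d/dt ⟨λ₀ x, x⟩ = -‖∫₀¹ z‖² ≤ 0` (`IsTransportSolution.eq_zero`). Hence the outflow is the inflow
delayed by `τ` (`IsTransportSolution.ae_traces`), and every law `w₀ = A w₁ + g` relating the traces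
is a delay equation solved period by period (`exists_isTransportSolution_of_feedback`,
`IsTransportSolution.unique_of_feedback`). This covers the open and the closed loop.

*Optimality.* Solving the boundary condition for the inflow, almost every sequence
`x_k = w₁(s + kτ)`, `s ∈ (0, τ]`, is a trajectory of `x⁺ = A_d x + B_d u`, `y = C_d x + D_d u`
(`WaveNetwork.IsSolution.ae_discrete`), and the cost is the integral over `s` of the discrete-time
costs. The control Riccati equation completes the squares
(`IsCARESolution.completion_of_squares`): up to time `N` the cost equals
`⟨x₀, Π x₀⟩ - ⟨x_N, Π x_N⟩` plus weighted squares of `u_k - F_d x_k`. So the feedback `F_d` is the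
unique minimizer once `x_N → 0` along all trajectories of finite cost. That is detectability, which
follows from the filter Riccati equation because `Π` is stabilizing
(`IsFARESolution.spectralRadius_outputInjection_lt_one`).

*Stability.* In closed loop `f(s + kτ) = A_Π^k f(s)`, and the powers of `A_Π` decay geometrically
because its spectral radius is below one.
-/

/-! ### Powers of operators with spectral radius below one -/

/-- In a complex Banach algebra, the powers of an element of spectral radius below one decay
geometrically. -/
theorem exists_norm_pow_le_of_spectralRadius_lt_one {A : Type*} [NormedRing A] [NormedAlgebra ℂ A]
    [CompleteSpace A] {a : A} (ha : spectralRadius ℂ a < 1) :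
    ∃ C q : ℝ, 0 < C ∧ 0 < q ∧ q < 1 ∧ ∀ k : ℕ, ‖a ^ k‖ ≤ C * q ^ k := by
  obtain ⟨q, hq1, hq2⟩ := ENNReal.lt_iff_exists_nnreal_btwn.1 ha
  have hq0 : 0 < q := by
    have := lt_of_le_of_lt (zero_le) hq1
    exact_mod_cast this
  have hev : ∀ᶠ k : ℕ in Filter.atTop, ‖a ^ k‖ ≤ (q : ℝ) ^ k := by
    have h := spectrum.pow_nnnorm_pow_one_div_tendsto_nhds_spectralRadius a
    filter_upwards [h.eventually (gt_mem_nhds hq1), Filter.eventually_gt_atTop 0] with k hk hk0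
    have hk' : (0 : ℝ) < k := by exact_mod_cast hk0
    rw [one_div, ENNReal.rpow_inv_lt_iff hk', ENNReal.rpow_natCast] at hk
    have : ‖a ^ k‖₊ < q ^ k := by exact_mod_cast hk
    exact_mod_cast this.le
  obtain ⟨N, hN⟩ := Filter.eventually_atTop.1 hev
  have hq0' : (0 : ℝ) < q := hq0
  refine ⟨1 + ∑ i ∈ Finset.range N, ‖a ^ i‖ / (q : ℝ) ^ i, q, by positivity, hq0',
    by exact_mod_cast hq2, fun k => ?_⟩
  rcases lt_or_ge k N with hk | hk
  · rw [← div_le_iff₀ (by positivity)]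
    have := Finset.single_le_sum (f := fun i => ‖a ^ i‖ / (q : ℝ) ^ i)
      (fun i _ => by positivity) (Finset.mem_range.2 hk)
    linarith
  · refine (hN k hk).trans (le_mul_of_one_le_left (by positivity) ?_)
    have : 0 ≤ ∑ i ∈ Finset.range N, ‖a ^ i‖ / (q : ℝ) ^ i :=
      Finset.sum_nonneg fun i _ => by positivity
    linarith

theorem Matrix.toEuclideanLin_eq_toLp {m n : ℕ} (M : Matrix (Fin m) (Fin n) ℂ)
    (x : EuclideanSpace ℂ (Fin n)) : M.toEuclideanLin x = WithLp.toLp 2 (M *ᵥ x.ofLp) := rfl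

theorem Matrix.toEuclideanLin_mul_apply {l m n : ℕ} (M : Matrix (Fin l) (Fin m) ℂ)
    (N : Matrix (Fin m) (Fin n) ℂ) (x : EuclideanSpace ℂ (Fin n)) :
    (M * N).toEuclideanLin x = M.toEuclideanLin (N.toEuclideanLin x) := by
  simp [Matrix.toEuclideanLin_eq_toLp, Matrix.mulVec_mulVec]

theorem Matrix.toEuclideanLin_pow_succ_apply {n : ℕ} (T : Matrix (Fin n) (Fin n) ℂ) (k : ℕ)
    (x : EuclideanSpace ℂ (Fin n)) :
    (T ^ (k + 1)).toEuclideanLin x = T.toEuclideanLin ((T ^ k).toEuclideanLin x) := by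
  rw [pow_succ', Matrix.toEuclideanLin_mul_apply]

theorem Matrix.exists_norm_toEuclideanLin_le {m n : ℕ} (M : Matrix (Fin m) (Fin n) ℂ) :
    ∃ c : ℝ, 0 ≤ c ∧ ∀ x, ‖M.toEuclideanLin x‖ ≤ c * ‖x‖ :=
  ⟨‖LinearMap.toContinuousLinearMap M.toEuclideanLin‖, norm_nonneg _,
    (LinearMap.toContinuousLinearMap M.toEuclideanLin).le_opNorm⟩

theorem Matrix.continuous_toEuclideanLin {m n : ℕ} (M : Matrix (Fin m) (Fin n) ℂ) :
    Continuous M.toEuclideanLin :=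
  LinearMap.continuous_of_finiteDimensional _

theorem Matrix.exists_norm_pow_le_of_spectralRadius_lt_one {n : ℕ} {T : Matrix (Fin n) (Fin n) ℂ}
    (hT : spectralRadius ℂ T < 1) :
    ∃ C q : ℝ, 0 < C ∧ 0 < q ∧ q < 1 ∧
      ∀ (k : ℕ) (x), ‖(T ^ k).toEuclideanLin x‖ ≤ C * q ^ k * ‖x‖ := by
  let e := Matrix.toEuclideanCLM (n := Fin n) (𝕜 := ℂ)
  have h : spectralRadius ℂ (e T) < 1 := by
    have : spectrum ℂ (e T) = spectrum ℂ T := AlgEquiv.spectrum_eq e T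
    rwa [spectralRadius, this]
  obtain ⟨C, q, hC, hq, hq1, hle⟩ := _root_.exists_norm_pow_le_of_spectralRadius_lt_one h
  refine ⟨C, q, hC, hq, hq1, fun k x => ?_⟩
  have h1 : (T ^ k).toEuclideanLin x = (e T ^ k) x := by
    rw [← map_pow]; rfl
  rw [h1]
  exact ((e T ^ k).le_opNorm x).trans (mul_le_mul_of_nonneg_right (hle k) (norm_nonneg _))

/-- If all eigenvalues of a matrix lie in the open unit disc, its spectral radius is below one. -/
theorem Matrix.spectralRadius_lt_one_of_forall_eigenvector {n : ℕ} {T : Matrix (Fin n) (Fin n) ℂ}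
    (h : ∀ (μ : ℂ) (x : EuclideanSpace ℂ (Fin n)), x ≠ 0 → T.toEuclideanLin x = μ • x → ‖μ‖ < 1) :
    spectralRadius ℂ T < 1 := by
  have hsp : ∀ μ ∈ spectrum ℂ T, ‖μ‖ < 1 := by
    intro μ hμ
    rw [← Matrix.spectrum_toLpLin 2, ← Module.End.hasEigenvalue_iff_mem_spectrum] at hμ
    obtain ⟨x, hx⟩ := hμ.exists_hasEigenvector
    exact h μ x hx.2 hx.apply_eq_smul
  let e := Matrix.toEuclideanCLM (n := Fin n) (𝕜 := ℂ)
  have he : spectrum ℂ (e T) = spectrum ℂ T := AlgEquiv.spectrum_eq e T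
  have h1 : spectralRadius ℂ T = spectralRadius ℂ (e T) := by
    rw [spectralRadius, spectralRadius, he]
  rw [h1]
  rcases (spectrum ℂ (e T)).eq_empty_or_nonempty with h0 | h0
  · rw [spectralRadius, h0]; simp
  · have := spectrum.spectralRadius_lt_of_forall_lt_of_nonempty (a := e T) (r := 1) h0 ?_
    · simpa using this
    · intro k hk
      exact_mod_cast hsp k (he ▸ hk)

theorem Matrix.norm_lt_one_of_spectralRadius_lt_one {n : ℕ} {T : Matrix (Fin n) (Fin n) ℂ}
    (h : spectralRadius ℂ T < 1) {μ : ℂ} {x : EuclideanSpace ℂ (Fin n)} (hx : x ≠ 0)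
    (hTx : Tᴴ.toEuclideanLin x = μ • x) : ‖μ‖ < 1 := by
  have hμ : μ ∈ spectrum ℂ Tᴴ := by
    rw [← Matrix.spectrum_toLpLin 2, ← Module.End.hasEigenvalue_iff_mem_spectrum]
    exact Module.End.hasEigenvalue_of_hasEigenvector (x := x)
      ⟨Module.End.mem_eigenspace_iff.2 hTx, hx⟩
  have hμ' : star μ ∈ spectrum ℂ T := by
    rw [← Matrix.star_eq_conjTranspose, spectrum.map_star] at hμ
    exact hμ
  have : (‖star μ‖₊ : ℝ≥0∞) ≤ spectralRadius ℂ T :=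
    le_iSup₂ (f := fun k (_ : k ∈ spectrum ℂ T) => (‖k‖₊ : ℝ≥0∞)) (star μ) hμ'
  have := this.trans_lt h
  rw [nnnorm_star] at this
  exact_mod_cast this

/-- A geometrically stable discrete-time system driven by a null sequence tends to zero. -/
theorem tendsto_zero_of_stable_recursion {n : ℕ} {T : Matrix (Fin n) (Fin n) ℂ}
    (hT : spectralRadius ℂ T < 1) {x f : ℕ → EuclideanSpace ℂ (Fin n)}
    (hx : ∀ k, x (k + 1) = T.toEuclideanLin (x k) + f k)
    (hf : Filter.Tendsto f Filter.atTop (nhds 0)) : Filter.Tendsto x Filter.atTop (nhds 0) := by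
  obtain ⟨C, q, hC, hq, hq1, hle⟩ := Matrix.exists_norm_pow_le_of_spectralRadius_lt_one hT
  have hsol : ∀ k, x k = (T ^ k).toEuclideanLin (x 0) +
      ∑ i ∈ Finset.range k, (T ^ i).toEuclideanLin (f (k - 1 - i)) := by
    intro k
    induction k with
    | zero => simp
    | succ k ih =>
      rw [hx, ih, map_add, map_sum, ← Matrix.toEuclideanLin_pow_succ_apply, Finset.sum_range_succ',
        add_assoc]
      congr 2
      · refine Finset.sum_congr rfl fun i hi => ?_
        rw [← Matrix.toEuclideanLin_pow_succ_apply]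
        congr 2
        omega
      · simp
  obtain ⟨b, hb⟩ : ∃ b : ℝ, ∀ k, ‖f k‖ ≤ b := by
    obtain ⟨b, hb⟩ := hf.norm.bddAbove_range
    exact ⟨b, fun k => hb ⟨k, rfl⟩⟩
  have hb0 : 0 ≤ b := (norm_nonneg _).trans (hb 0)
  have h1 : Filter.Tendsto (fun k => (T ^ k).toEuclideanLin (x 0)) Filter.atTop (nhds 0) := by
    refine squeeze_zero_norm (fun k => hle k (x 0)) ?_
    have := ((tendsto_pow_atTop_nhds_zero_of_lt_one hq.le hq1).const_mul C).mul_const ‖x 0‖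
    simpa using this
  have h2 : Filter.Tendsto (fun k => ∑' i, if i < k then (T ^ i).toEuclideanLin (f (k - 1 - i))
      else 0) Filter.atTop (nhds (∑' _ : ℕ, 0)) := by
    refine tendsto_tsum_of_dominated_convergence (bound := fun i => C * q ^ i * b) ?_ ?_ ?_
    · exact ((summable_geometric_of_lt_one hq.le hq1).mul_left C).mul_right b
    · intro i
      have h3 : Filter.Tendsto (fun k => (T ^ i).toEuclideanLin (f (k - 1 - i)))
          Filter.atTop (nhds 0) := by
        have h4 := ((Matrix.continuous_toEuclideanLin (T ^ i)).tendsto 0).comp (hf.comp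
          ((Filter.tendsto_sub_atTop_nat i).comp (Filter.tendsto_sub_atTop_nat 1)))
        rw [map_zero] at h4
        exact h4
      refine h3.congr' ?_
      filter_upwards [Filter.eventually_gt_atTop i] with k hk
      rw [if_pos hk]
    · refine Filter.Eventually.of_forall fun k i => ?_
      split_ifs
      · exact (hle i _).trans (mul_le_mul_of_nonneg_left (hb _) (by positivity))
      · rw [norm_zero]; positivity
  have h3 : ∀ k, (∑' i, if i < k then (T ^ i).toEuclideanLin (f (k - 1 - i)) else 0) =
      ∑ i ∈ Finset.range k, (T ^ i).toEuclideanLin (f (k - 1 - i)) := by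
    intro k
    rw [tsum_eq_sum (s := Finset.range k)]
    · exact Finset.sum_congr rfl fun i hi => if_pos (Finset.mem_range.1 hi)
    · intro i hi
      exact if_neg fun h => hi (Finset.mem_range.2 h)
  simp only [h3, tsum_zero] at h2
  have := h1.add h2
  simp only [← hsol, add_zero] at this
  exact this

/-! ### Completion of squares for the Riccati equations -/

section Riccati

variable {n p m : ℕ} {A : Matrix (Fin n) (Fin n) ℂ} {B : Matrix (Fin n) (Fin p) ℂ}
  {C : Matrix (Fin m) (Fin n) ℂ} {D : Matrix (Fin m) (Fin p) ℂ} {X Y : Matrix (Fin n) (Fin n) ℂ}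

/-- The quadratic form `x ↦ ⟨x, X x⟩` of a matrix. -/
noncomputable def Matrix.quadForm {n : ℕ} (X : Matrix (Fin n) (Fin n) ℂ) (x : EuclideanSpace ℂ (Fin n)) : ℝ :=
  (inner ℂ x (X.toEuclideanLin x)).re

theorem Matrix.quadForm_eq {n : ℕ} (X : Matrix (Fin n) (Fin n) ℂ)
    (x : EuclideanSpace ℂ (Fin n)) :
    X.quadForm x = (((replicateCol Unit x.ofLp)ᴴ * X * replicateCol Unit x.ofLp) () ()).re := by
  rw [Matrix.mul_assoc, ← Matrix.replicateCol_mulVec, Matrix.quadForm,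
    EuclideanSpace.inner_eq_star_dotProduct, Matrix.toEuclideanLin_eq_toLp]
  simp [Matrix.mul_apply, dotProduct, mul_comm]

theorem Matrix.quadForm_one {n : ℕ} (x : EuclideanSpace ℂ (Fin n)) :
    (1 : Matrix (Fin n) (Fin n) ℂ).quadForm x = ‖x‖ ^ 2 := by
  have : (1 : Matrix (Fin n) (Fin n) ℂ).toEuclideanLin x = x := by
    simp
  rw [Matrix.quadForm, this]
  exact inner_self_eq_norm_sq (𝕜 := ℂ) x

theorem Matrix.quadForm_smul {n : ℕ} (X : Matrix (Fin n) (Fin n) ℂ) (μ : ℂ)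
    (x : EuclideanSpace ℂ (Fin n)) : X.quadForm (μ • x) = ‖μ‖ ^ 2 * X.quadForm x := by
  rw [Matrix.quadForm, map_smul, inner_smul_left, inner_smul_right, ← mul_assoc,
    ← Complex.normSq_eq_conj_mul_self, Complex.re_ofReal_mul, Complex.normSq_eq_norm_sq]
  rfl

theorem Matrix.PosSemidef.quadForm_nonneg {n : ℕ} {X : Matrix (Fin n) (Fin n) ℂ}
    (hX : X.PosSemidef) (x : EuclideanSpace ℂ (Fin n)) : 0 ≤ X.quadForm x := by
  have := (Matrix.isPositive_toEuclideanLin_iff.2 hX).re_inner_nonneg_right x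
  exact this

theorem Matrix.continuous_quadForm {n : ℕ} (X : Matrix (Fin n) (Fin n) ℂ) :
    Continuous X.quadForm :=
  Complex.continuous_re.comp (continuous_id.inner X.continuous_toEuclideanLin)

/-- The optimal feedback gain `-(1 + D*D + B*XB)⁻¹ (D*C + B*XA)` of the linear quadratic problem. -/
noncomputable def riccatiGain (A : Matrix (Fin n) (Fin n) ℂ) (B : Matrix (Fin n) (Fin p) ℂ)
    (C : Matrix (Fin m) (Fin n) ℂ) (D : Matrix (Fin m) (Fin p) ℂ) (X : Matrix (Fin n) (Fin n) ℂ) :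
    Matrix (Fin p) (Fin n) ℂ :=
  -((1 + Dᴴ * D + Bᴴ * X * B)⁻¹ * (Dᴴ * C + Bᴴ * X * A))

theorem Matrix.PosSemidef.posDef_riccati (hX : X.PosSemidef) (B : Matrix (Fin n) (Fin p) ℂ)
    (D : Matrix (Fin m) (Fin p) ℂ) : (1 + Dᴴ * D + Bᴴ * X * B).PosDef :=
  (Matrix.PosDef.one.add_posSemidef (posSemidef_conjTranspose_mul_self D)).add_posSemidef
    (hX.conjTranspose_mul_mul_same B)

/-- Completion of squares: along `x⁺ = A x + B u`, `y = C x + D u`, the running cost plus the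
increment of the value function is the weighted square of the deviation of `u` from the optimal
feedback. -/
theorem IsCARESolution.completion_of_squares (h : IsCARESolution A B C D X)
    (x : EuclideanSpace ℂ (Fin n)) (u : EuclideanSpace ℂ (Fin p)) :
    ‖C.toEuclideanLin x + D.toEuclideanLin u‖ ^ 2 + ‖u‖ ^ 2 +
        X.quadForm (A.toEuclideanLin x + B.toEuclideanLin u) =
      X.quadForm x + (1 + Dᴴ * D + Bᴴ * X * B).quadForm
        (u - (riccatiGain A B C D X).toEuclideanLin x) := by
  obtain ⟨hX, hR⟩ := h
  set R := 1 + Dᴴ * D + Bᴴ * X * B with hRdef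
  have hRpos : R.PosDef := hX.posDef_riccati B D
  have hdet : IsUnit R.det := (Matrix.isUnit_iff_isUnit_det _).1 hRpos.isUnit
  set F := riccatiGain A B C D X with hF
  have hRF : R * F = -(Dᴴ * C + Bᴴ * X * A) := by
    rw [hF, riccatiGain, ← hRdef, Matrix.mul_neg, Matrix.mul_nonsing_inv_cancel_left _ _ hdet]
  have hFR : Fᴴ * R = -(Cᴴ * D + Aᴴ * X * B) := by
    have := congrArg conjTranspose hRF
    rw [conjTranspose_mul, hRpos.isHermitian.eq] at this
    rw [this]
    simp [conjTranspose_mul, conjTranspose_add, hX.isHermitian.eq, Matrix.mul_assoc]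
  have hcare : Aᴴ * X * A + Cᴴ * C = X + Fᴴ * R * F := by
    have h1 : (Cᴴ * D + Aᴴ * X * B) * R⁻¹ * (Dᴴ * C + Bᴴ * X * A) = Fᴴ * R * F := by
      rw [hFR, hF, riccatiGain, ← hRdef, Matrix.mul_neg, Matrix.neg_mul, neg_neg,
        Matrix.mul_assoc, Matrix.mul_assoc]
    rw [h1] at hR
    rw [← hR]; abel
  rw [← Matrix.quadForm_one, ← Matrix.quadForm_one, Matrix.quadForm_eq, Matrix.quadForm_eq,
    Matrix.quadForm_eq, Matrix.quadForm_eq, Matrix.quadForm_eq, ← Complex.add_re,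
    ← Complex.add_re, ← Complex.add_re, ← Matrix.add_apply, ← Matrix.add_apply,
    ← Matrix.add_apply]
  have hcol : ∀ {k l : ℕ} (M : Matrix (Fin k) (Fin l) ℂ) (z : EuclideanSpace ℂ (Fin l)),
      replicateCol Unit (M.toEuclideanLin z).ofLp = M * replicateCol Unit z.ofLp := by
    intro k l M z
    rw [Matrix.toEuclideanLin_eq_toLp, ← Matrix.replicateCol_mulVec]
  simp only [WithLp.ofLp_add, WithLp.ofLp_sub, replicateCol_add, hcol]
  have hsub : replicateCol Unit (u.ofLp - (F.toEuclideanLin x).ofLp) =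
      replicateCol Unit u.ofLp - F * replicateCol Unit x.ofLp := by
    rw [← hcol]; rfl
  rw [hsub]
  set a := replicateCol Unit x.ofLp
  set b := replicateCol Unit u.ofLp
  refine congrArg (fun M : Matrix Unit Unit ℂ => (M () ()).re) ?_
  have e1 : (b - F * a)ᴴ * R * (b - F * a) =
      bᴴ * R * b - bᴴ * (R * F) * a - aᴴ * (Fᴴ * R) * b + aᴴ * (Fᴴ * R * F) * a := by
    simp only [conjTranspose_sub, conjTranspose_mul, Matrix.sub_mul, Matrix.mul_sub,
      Matrix.mul_assoc]
    abel
  have e2 : aᴴ * (Fᴴ * R * F) * a = aᴴ * (Aᴴ * X * A + Cᴴ * C) * a - aᴴ * X * a := by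
    rw [hcare, Matrix.mul_add _ X, Matrix.add_mul _ _ a, add_sub_cancel_left]
  rw [e1, e2, hRF, hFR, hRdef]
  simp only [conjTranspose_add, conjTranspose_mul, Matrix.add_mul, Matrix.mul_add, Matrix.mul_neg,
    Matrix.neg_mul, Matrix.mul_assoc, Matrix.mul_one]
  abel

/-! ### Detectability from the filter Riccati equation -/

theorem Matrix.spectralRadius_conjTranspose_le (T : Matrix (Fin n) (Fin n) ℂ) :
    spectralRadius ℂ Tᴴ ≤ spectralRadius ℂ T := by
  refine iSup₂_le fun k hk => ?_
  rw [← Matrix.star_eq_conjTranspose, spectrum.map_star] at hk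
  refine le_iSup₂_of_le (star k) hk ?_
  rw [nnnorm_star]

/-- The filter Riccati equation is the control Riccati equation of the dual system. -/
theorem IsFARESolution.dual (h : IsFARESolution A B C D Y) :
    IsCARESolution Aᴴ Cᴴ Bᴴ Dᴴ Y := by
  refine ⟨h.1, ?_⟩
  simpa only [conjTranspose_conjTranspose] using h.2

/-- A nonnegative solution of the filter Riccati equation together with a stabilizing feedback
makes the system detectable: the filter gain is a stabilizing output injection. An unstable
eigenvector of the dual closed loop has vanishing running cost by the Riccati equation, so it is
an uncontrollable unstable mode, and feedback cannot move it. -/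
theorem IsFARESolution.spectralRadius_outputInjection_lt_one (h : IsFARESolution A B C D Y)
    {F : Matrix (Fin p) (Fin n) ℂ} (hs : spectralRadius ℂ (A + B * F) < 1) :
    spectralRadius ℂ (A + (riccatiGain Aᴴ Cᴴ Bᴴ Dᴴ Y)ᴴ * C) < 1 := by
  set G := riccatiGain Aᴴ Cᴴ Bᴴ Dᴴ Y with hG
  have hT : A + Gᴴ * C = (Aᴴ + Cᴴ * G)ᴴ := by
    simp [conjTranspose_add, conjTranspose_mul]
  rw [hT]
  refine (Matrix.spectralRadius_conjTranspose_le _).trans_lt ?_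
  refine Matrix.spectralRadius_lt_one_of_forall_eigenvector fun μ x hx hμ => ?_
  by_contra! hμ1
  have hsq := h.dual.completion_of_squares x (G.toEuclideanLin x)
  rw [← hG, sub_self] at hsq
  have h0 : ∀ {k : ℕ} (M : Matrix (Fin k) (Fin k) ℂ), M.quadForm 0 = 0 := fun M => by
    simp [Matrix.quadForm]
  have hstep : Aᴴ.toEuclideanLin x + Cᴴ.toEuclideanLin (G.toEuclideanLin x) = μ • x := by
    rw [← hμ, map_add, LinearMap.add_apply, Matrix.toEuclideanLin_mul_apply]
  rw [h0, add_zero, hstep, Matrix.quadForm_smul] at hsq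
  have hV := h.1.quadForm_nonneg x
  have h1 : Y.quadForm x ≤ ‖μ‖ ^ 2 * Y.quadForm x :=
    le_mul_of_one_le_left hV (one_le_pow₀ hμ1)
  have hu : G.toEuclideanLin x = 0 := by
    have : ‖G.toEuclideanLin x‖ ^ 2 = 0 := by
      refine le_antisymm ?_ (by positivity)
      have : 0 ≤ ‖Bᴴ.toEuclideanLin x + Dᴴ.toEuclideanLin (G.toEuclideanLin x)‖ ^ 2 := by
        positivity
      linarith
    simpa using this
  rw [hu, map_zero, add_zero] at hsq hstep
  have hB : Bᴴ.toEuclideanLin x = 0 := by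
    have : ‖Bᴴ.toEuclideanLin x‖ ^ 2 = 0 := by
      refine le_antisymm ?_ (by positivity)
      simp only [norm_zero] at hsq
      linarith
    simpa using this
  have hAF : (A + B * F)ᴴ.toEuclideanLin x = μ • x := by
    rw [conjTranspose_add, conjTranspose_mul, map_add, LinearMap.add_apply,
      Matrix.toEuclideanLin_mul_apply, hB, map_zero, add_zero, hstep]
  exact absurd (Matrix.norm_lt_one_of_spectralRadius_lt_one hs hx hAF) (not_lt.2 hμ1)

/-! ### The discrete-time linear quadratic problem -/

theorem IsCARESolution.sum_cost_add_quadForm (h : IsCARESolution A B C D X)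
    {x : ℕ → EuclideanSpace ℂ (Fin n)} {u : ℕ → EuclideanSpace ℂ (Fin p)}
    {y : ℕ → EuclideanSpace ℂ (Fin m)}
    (hx : ∀ k, x (k + 1) = A.toEuclideanLin (x k) + B.toEuclideanLin (u k))
    (hy : ∀ k, y k = C.toEuclideanLin (x k) + D.toEuclideanLin (u k)) (N : ℕ) :
    ∑ k ∈ Finset.range N, (‖y k‖ ^ 2 + ‖u k‖ ^ 2) + X.quadForm (x N) =
      X.quadForm (x 0) + ∑ k ∈ Finset.range N, (1 + Dᴴ * D + Bᴴ * X * B).quadForm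
        (u k - (riccatiGain A B C D X).toEuclideanLin (x k)) := by
  induction N with
  | zero => simp
  | succ N ih =>
    have := h.completion_of_squares (x N) (u N)
    rw [← hx, ← hy] at this
    rw [Finset.sum_range_succ, Finset.sum_range_succ]
    linarith

theorem ofReal_norm_sq_add_norm_sq {E F : Type*} [NormedAddCommGroup E] [NormedAddCommGroup F]
    (y : E) (u : F) : ENNReal.ofReal (‖y‖ ^ 2 + ‖u‖ ^ 2) = ‖y‖ₑ ^ 2 + ‖u‖ₑ ^ 2 := by
  rw [ENNReal.ofReal_add (by positivity) (by positivity), ENNReal.ofReal_pow (norm_nonneg _),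
    ENNReal.ofReal_pow (norm_nonneg _), ofReal_norm, ofReal_norm]

/-- The optimal feedback achieves a cost of at most `⟨x₀, X x₀⟩`. -/
theorem IsCARESolution.tsum_cost_le (h : IsCARESolution A B C D X)
    {x : ℕ → EuclideanSpace ℂ (Fin n)} {u : ℕ → EuclideanSpace ℂ (Fin p)}
    {y : ℕ → EuclideanSpace ℂ (Fin m)}
    (hx : ∀ k, x (k + 1) = A.toEuclideanLin (x k) + B.toEuclideanLin (u k))
    (hy : ∀ k, y k = C.toEuclideanLin (x k) + D.toEuclideanLin (u k))
    (hu : ∀ k, u k = (riccatiGain A B C D X).toEuclideanLin (x k)) :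
    ∑' k, (‖y k‖ₑ ^ 2 + ‖u k‖ₑ ^ 2) ≤ ENNReal.ofReal (X.quadForm (x 0)) := by
  simp only [← ofReal_norm_sq_add_norm_sq]
  refine ENNReal.tsum_le_of_sum_range_le fun N => ?_
  rw [← ENNReal.ofReal_sum_of_nonneg fun k _ => by positivity]
  refine ENNReal.ofReal_le_ofReal ?_
  have h1 := h.sum_cost_add_quadForm hx hy N
  have h2 : ∑ k ∈ Finset.range N, (1 + Dᴴ * D + Bᴴ * X * B).quadForm
      (u k - (riccatiGain A B C D X).toEuclideanLin (x k)) = 0 := by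
    refine Finset.sum_eq_zero fun k _ => ?_
    rw [hu k, sub_self]
    simp [Matrix.quadForm]
  have := h.1.quadForm_nonneg (x N)
  linarith

/-- Every control costs at least `⟨x₀, X x₀⟩` plus the penalty for a deviation from the optimal
feedback at any single time. If the cost is finite, detectability forces the state to tend to
zero, so that no part of the value is left over at infinity. -/
theorem IsCARESolution.le_tsum_cost (h : IsCARESolution A B C D X)
    {L : Matrix (Fin n) (Fin m) ℂ} (hL : spectralRadius ℂ (A + L * C) < 1)
    {x : ℕ → EuclideanSpace ℂ (Fin n)} {u : ℕ → EuclideanSpace ℂ (Fin p)}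
    {y : ℕ → EuclideanSpace ℂ (Fin m)}
    (hx : ∀ k, x (k + 1) = A.toEuclideanLin (x k) + B.toEuclideanLin (u k))
    (hy : ∀ k, y k = C.toEuclideanLin (x k) + D.toEuclideanLin (u k)) (j : ℕ) :
    ENNReal.ofReal (X.quadForm (x 0) + (1 + Dᴴ * D + Bᴴ * X * B).quadForm
      (u j - (riccatiGain A B C D X).toEuclideanLin (x j))) ≤
        ∑' k, (‖y k‖ₑ ^ 2 + ‖u k‖ₑ ^ 2) := by
  simp only [← ofReal_norm_sq_add_norm_sq]
  by_cases hfin : ∑' k, ENNReal.ofReal (‖y k‖ ^ 2 + ‖u k‖ ^ 2) = ∞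
  · rw [hfin]; exact le_top
  have hsum : Summable fun k => ‖y k‖ ^ 2 + ‖u k‖ ^ 2 := by
    have := ENNReal.summable_toReal hfin
    refine this.congr fun k => ?_
    rw [ENNReal.toReal_ofReal (by positivity)]
  have hsq : ∀ {k : ℕ} {w : ℕ → EuclideanSpace ℂ (Fin k)},
      (∀ i, ‖w i‖ ^ 2 ≤ ‖y i‖ ^ 2 + ‖u i‖ ^ 2) →
      Filter.Tendsto w Filter.atTop (nhds 0) := by
    intro k w hw
    rw [tendsto_zero_iff_norm_tendsto_zero]
    have h1 : Filter.Tendsto (fun i => ‖w i‖ ^ 2) Filter.atTop (nhds 0) :=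
      squeeze_zero (fun i => by positivity) hw hsum.tendsto_atTop_zero
    have h2 := (Real.continuous_sqrt.tendsto 0).comp h1
    simpa [Function.comp_def, Real.sqrt_sq] using h2
  have hy0 : Filter.Tendsto y Filter.atTop (nhds 0) :=
    hsq fun i => le_add_of_nonneg_right (by positivity)
  have hu0 : Filter.Tendsto u Filter.atTop (nhds 0) :=
    hsq fun i => le_add_of_nonneg_left (by positivity)
  have hx0 : Filter.Tendsto x Filter.atTop (nhds 0) := by
    refine tendsto_zero_of_stable_recursion hL
      (f := fun k => (B + L * D).toEuclideanLin (u k) - L.toEuclideanLin (y k)) (fun k => ?_) ?_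
    · rw [hx, hy]
      simp only [map_add, LinearMap.add_apply, Matrix.toEuclideanLin_mul_apply]
      abel
    · have h1 := ((Matrix.continuous_toEuclideanLin (B + L * D)).tendsto 0).comp hu0
      have h2 := ((Matrix.continuous_toEuclideanLin L).tendsto 0).comp hy0
      have h3 := h1.sub h2
      rw [map_zero, map_zero, sub_zero] at h3
      exact h3
  have hV0 : Filter.Tendsto (fun N => X.quadForm (x N)) Filter.atTop (nhds 0) := by
    have := (X.continuous_quadForm.tendsto 0).comp hx0
    simpa [Matrix.quadForm, Function.comp_def] using this
  rw [← ENNReal.ofReal_tsum_of_nonneg (fun k => by positivity) hsum]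
  refine ENNReal.ofReal_le_ofReal ?_
  have hlim := hsum.hasSum.tendsto_sum_nat.add hV0
  rw [add_zero] at hlim
  refine ge_of_tendsto hlim ?_
  filter_upwards [Filter.eventually_gt_atTop j] with N hN
  rw [h.sum_cost_add_quadForm hx hy N]
  have := Finset.single_le_sum (f := fun k => (1 + Dᴴ * D + Bᴴ * X * B).quadForm
      (u k - (riccatiGain A B C D X).toEuclideanLin (x k)))
      (fun i _ => (h.1.posDef_riccati B D).posSemidef.quadForm_nonneg _) (Finset.mem_range.2 hN)
  linarith

theorem Matrix.PosDef.eq_zero_of_quadForm_le {R : Matrix (Fin p) (Fin p) ℂ} (hR : R.PosDef)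
    {v : EuclideanSpace ℂ (Fin p)} (hv : R.quadForm v ≤ 0) : v = 0 := by
  by_contra hne
  have h1 : v.ofLp ≠ 0 := fun h => hne (by ext i; exact congrFun h i)
  have h2 := (Complex.pos_iff.1 (hR.dotProduct_mulVec_pos h1)).1
  rw [Matrix.quadForm, EuclideanSpace.inner_eq_star_dotProduct, Matrix.toEuclideanLin_eq_toLp,
    dotProduct_comm] at hv
  exact absurd h2 (not_lt.2 hv)

end Riccati

/-! ### Uniqueness of mild solutions of the transport equation -/

section Transport

variable {n : ℕ}

theorem StateSpace.intervalIntegrable (v : StateSpace n) {ζ : ℝ} (hζ : ζ ∈ Icc (0 : ℝ) 1) :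
    IntervalIntegrable v volume 0 ζ := by
  have h : Integrable v spaceMeasure := (Lp.memLp v).integrable (by norm_num)
  rw [intervalIntegrable_iff_integrableOn_Ioo_of_le hζ.1]
  exact IntegrableOn.mono_set h (Ioo_subset_Ioo_right hζ.2)

theorem StateSpace.intervalIntegral_congr {v w : ℝ → EuclideanSpace ℂ (Fin n)}
    (h : v =ᵐ[spaceMeasure] w) {ζ : ℝ} (hζ : ζ ∈ Icc (0 : ℝ) 1) :
    ∫ s in (0 : ℝ)..ζ, v s = ∫ s in (0 : ℝ)..ζ, w s := by
  rw [intervalIntegral.integral_of_le hζ.1, intervalIntegral.integral_of_le hζ.1,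
    ← restrict_Ioo_eq_restrict_Ioc]
  exact integral_congr_ae (ae_mono (Measure.restrict_mono (Ioo_subset_Ioo_right hζ.2) le_rfl) h)

theorem L2Loc.intervalIntegrable {k : ℕ} {w : ℝ → EuclideanSpace ℂ (Fin k)} (hw : L2Loc w) {t : ℝ}
    (ht : 0 ≤ t) : IntervalIntegrable w volume 0 t := by
  rw [intervalIntegrable_iff_integrableOn_Ioc_of_le ht]
  exact (hw t).integrable (by norm_num)

theorem HasDerivAndTraces.sub {lam : ℝ → ℝ} {x x' v v' : StateSpace n}
    {a a' b b' : EuclideanSpace ℂ (Fin n)} (h : HasDerivAndTraces lam x v a b)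
    (h' : HasDerivAndTraces lam x' v' a' b') :
    HasDerivAndTraces lam (x - x') (v - v') (a - a') (b - b') := by
  have hint : ∀ ζ ∈ Icc (0 : ℝ) 1, ∫ s in (0 : ℝ)..ζ, (v - v' : StateSpace n) s =
      (∫ s in (0 : ℝ)..ζ, v s) - ∫ s in (0 : ℝ)..ζ, v' s := fun ζ hζ => by
    rw [← intervalIntegral.integral_sub (v.intervalIntegrable hζ) (v'.intervalIntegrable hζ)]
    exact StateSpace.intervalIntegral_congr (Lp.coeFn_sub v v') hζ
  refine ⟨?_, ?_⟩
  · filter_upwards [h.1, h'.1, Lp.coeFn_sub x x', ae_restrict_mem measurableSet_Ioo]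
      with ζ h1 h2 h3 hζ
    rw [h3, Pi.sub_apply, smul_sub, h1, h2, hint ζ ⟨hζ.1.le, hζ.2.le⟩]
    abel
  · rw [h.2, h'.2, hint 1 ⟨zero_le_one, le_rfl⟩]
    abel

theorem IsTransportSolution.sub {lam : ℝ → ℝ} {z₀ z₀' : StateSpace n} {z z' : ℝ → StateSpace n}
    {w₀ w₁ w₀' w₁' : ℝ → EuclideanSpace ℂ (Fin n)} (h : IsTransportSolution lam z₀ z w₀ w₁)
    (h' : IsTransportSolution lam z₀' z' w₀' w₁') :
    IsTransportSolution lam (z₀ - z₀') (z - z') (w₀ - w₀') (w₁ - w₁') where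
  continuousOn := h.continuousOn.sub h'.continuousOn
  init := by rw [Pi.sub_apply, h.init, h'.init]
  trace_zero T := (h.trace_zero T).sub (h'.trace_zero T)
  trace_one T := (h.trace_one T).sub (h'.trace_one T)
  equation t ht := by
    have hc : ∀ {z : ℝ → StateSpace n}, ContinuousOn z (Ici 0) →
        IntervalIntegrable z volume 0 t := fun hz =>
      (hz.mono (by rw [uIcc_of_le ht]; exact Icc_subset_Ici_self)).intervalIntegrable
    have := (h.equation t ht).sub (h'.equation t ht)
    simp only [Pi.sub_apply]
    rw [intervalIntegral.integral_sub (hc h.continuousOn) (hc h'.continuousOn),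
      intervalIntegral.integral_sub (h.trace_zero.intervalIntegrable ht)
        (h'.trace_zero.intervalIntegrable ht),
      intervalIntegral.integral_sub (h.trace_one.intervalIntegrable ht)
        (h'.trace_one.intervalIntegrable ht), sub_sub_sub_comm]
    exact this

/-- The quadratic form of the Volterra operator is nonnegative, for real scalar functions. -/
theorem integral_primitive_mul_self_nonneg {f : ℝ → ℝ} (hf : IntervalIntegrable f volume 0 1) :
    0 ≤ ∫ ζ in (0 : ℝ)..1, (∫ s in (0 : ℝ)..ζ, f s) * f ζ := by
  have hac := hf.absolutelyContinuousOnInterval_intervalIntegral (c := 0) (by simp)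
  have hparts := hac.integral_mul_deriv_eq_deriv_mul hac
  have hderiv : ∀ᵐ ζ : ℝ, ζ ∈ uIoc (0 : ℝ) 1 →
      deriv (fun x => ∫ s in (0 : ℝ)..x, f s) ζ = f ζ := by
    filter_upwards [hf.ae_hasDerivAt_integral] with ζ hζ hmem
    exact (hζ (uIoc_subset_uIcc hmem) 0 (by simp)).deriv
  have h1 : ∫ ζ in (0 : ℝ)..1, (∫ s in (0 : ℝ)..ζ, f s) *
      deriv (fun x => ∫ s in (0 : ℝ)..x, f s) ζ =
      ∫ ζ in (0 : ℝ)..1, (∫ s in (0 : ℝ)..ζ, f s) * f ζ := by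
    refine intervalIntegral.integral_congr_ae ?_
    filter_upwards [hderiv] with ζ h hmem
    rw [h hmem]
  have h2 : ∫ ζ in (0 : ℝ)..1, deriv (fun x => ∫ s in (0 : ℝ)..x, f s) ζ *
      (∫ s in (0 : ℝ)..ζ, f s) = ∫ ζ in (0 : ℝ)..1, (∫ s in (0 : ℝ)..ζ, f s) * f ζ := by
    refine intervalIntegral.integral_congr_ae ?_
    filter_upwards [hderiv] with ζ h hmem
    rw [h hmem, mul_comm]
  rw [h1, h2, intervalIntegral.integral_same] at hparts
  nlinarith [mul_self_nonneg (∫ s in (0 : ℝ)..1, f s)]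

/-- The quadratic form of the Volterra operator is nonnegative on `L²(0,1;ℂⁿ)`. -/
theorem integral_re_inner_primitive_nonneg (v : StateSpace n) :
    0 ≤ ∫ ζ, (inner ℂ (∫ s in (0 : ℝ)..ζ, v s) (v ζ)).re ∂spaceMeasure := by
  have hv := v.intervalIntegrable (ζ := 1) ⟨zero_le_one, le_rfl⟩
  let re (i : Fin n) : EuclideanSpace ℂ (Fin n) →L[ℝ] ℝ :=
    Complex.reCLM.comp ((EuclideanSpace.proj (𝕜 := ℂ) i).restrictScalars ℝ)
  let im (i : Fin n) : EuclideanSpace ℂ (Fin n) →L[ℝ] ℝ :=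
    Complex.imCLM.comp ((EuclideanSpace.proj (𝕜 := ℂ) i).restrictScalars ℝ)
  have hint : ∀ L : EuclideanSpace ℂ (Fin n) →L[ℝ] ℝ,
      IntervalIntegrable (fun s => L (v s)) volume 0 1 := fun L =>
    ⟨L.integrable_comp hv.1, L.integrable_comp hv.2⟩
  have hcomm : ∀ (L : EuclideanSpace ℂ (Fin n) →L[ℝ] ℝ), ∀ ζ ∈ Icc (0 : ℝ) 1,
      L (∫ s in (0 : ℝ)..ζ, v s) = ∫ s in (0 : ℝ)..ζ, L (v s) := fun L ζ hζ =>
    (L.intervalIntegral_comp_comm (v.intervalIntegrable hζ)).symm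
  have hprod : ∀ L : EuclideanSpace ℂ (Fin n) →L[ℝ] ℝ,
      IntervalIntegrable (fun ζ => (∫ s in (0 : ℝ)..ζ, L (v s)) * L (v ζ)) volume 0 1 := fun L =>
    (hint L).continuousOn_mul
      (intervalIntegral.continuousOn_primitive_interval' (hint L) (by simp))
  have hexp : ∀ ζ ∈ Icc (0 : ℝ) 1, (inner ℂ (∫ s in (0 : ℝ)..ζ, v s) (v ζ)).re =
      ∑ i, ((∫ s in (0 : ℝ)..ζ, re i (v s)) * re i (v ζ) +
        (∫ s in (0 : ℝ)..ζ, im i (v s)) * im i (v ζ)) := by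
    intro ζ hζ
    rw [PiLp.inner_apply, Complex.re_sum]
    refine Finset.sum_congr rfl fun i _ => ?_
    rw [← hcomm _ ζ hζ, ← hcomm _ ζ hζ]
    simp [re, im]
    ring
  have h1 : ∫ ζ, (inner ℂ (∫ s in (0 : ℝ)..ζ, v s) (v ζ)).re ∂spaceMeasure =
      ∫ ζ in (0 : ℝ)..1, ∑ i, ((∫ s in (0 : ℝ)..ζ, re i (v s)) * re i (v ζ) +
        (∫ s in (0 : ℝ)..ζ, im i (v s)) * im i (v ζ)) := by
    rw [intervalIntegral.integral_of_le zero_le_one, ← restrict_Ioo_eq_restrict_Ioc]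
    refine integral_congr_ae ?_
    filter_upwards [ae_restrict_mem measurableSet_Ioo] with ζ hζ
    exact hexp ζ ⟨hζ.1.le, hζ.2.le⟩
  rw [h1, intervalIntegral.integral_finsetSum fun i _ => (hprod _).add (hprod _)]
  refine Finset.sum_nonneg fun i _ => ?_
  rw [intervalIntegral.integral_add (hprod _) (hprod _)]
  exact add_nonneg (integral_primitive_mul_self_nonneg (hint _))
    (integral_primitive_mul_self_nonneg (hint _))

/-- Multiplication by an essentially bounded real function, as an operator on the state space. -/
theorem exists_multiplication_operator {lam : ℝ → ℝ} (hlam : MemLp lam ∞ spaceMeasure) :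
    ∃ N : StateSpace n →L[ℝ] StateSpace n, ∀ x, N x =ᵐ[spaceMeasure] fun ζ => lam ζ • x ζ := by
  refine ⟨(ContinuousLinearMap.lsmul ℝ ℝ : ℝ →L[ℝ] EuclideanSpace ℂ (Fin n) →L[ℝ] _).holderL
    spaceMeasure ∞ 2 2 (hlam.toLp lam), fun x => ?_⟩
  have h := (ContinuousLinearMap.lsmul ℝ ℝ : ℝ →L[ℝ] EuclideanSpace ℂ (Fin n) →L[ℝ]
    _).coeFn_holder (r := 2) (hlam.toLp lam) x
  filter_upwards [h, hlam.coeFn_toLp] with ζ h1 h2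
  rw [h2] at h1
  exact h1

theorem ae_eq_zero_of_intervalIntegral_eq_zero {k : ℕ} {w : ℝ → EuclideanSpace ℂ (Fin k)}
    (hw : L2Loc w) (h : ∀ t, 0 ≤ t → ∫ s in (0 : ℝ)..t, w s = 0) :
    w =ᵐ[volume.restrict (Ioi (0 : ℝ))] 0 := by
  rw [Filter.EventuallyEq, ae_restrict_iff' measurableSet_Ioi]
  have hall : ∀ᵐ t : ℝ, ∀ N : ℕ, t ∈ uIcc (0 : ℝ) N → ∀ c ∈ uIcc (0 : ℝ) N,
      HasDerivAt (fun x => ∫ s in c..x, w s) (w t) t :=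
    ae_all_iff.2 fun N => (hw.intervalIntegrable N.cast_nonneg).ae_hasDerivAt_integral
  filter_upwards [hall] with t ht htpos
  obtain ⟨N, hN⟩ := exists_nat_ge t
  have hmem : t ∈ uIcc (0 : ℝ) N := by
    rw [uIcc_of_le N.cast_nonneg]; exact ⟨(mem_Ioi.1 htpos).le, hN⟩
  have h1 := ht N hmem 0 (by simp)
  have h2 : HasDerivAt (fun x => ∫ s in (0 : ℝ)..x, w s) 0 t := by
    refine (hasDerivAt_const t (0 : EuclideanSpace ℂ (Fin k))).congr_of_eventuallyEq ?_
    filter_upwards [Ioi_mem_nhds htpos] with s hs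
    exact h s (le_of_lt hs)
  exact h1.unique h2

/-- Energy estimate: a mild solution of the transport equation with vanishing initial state and
vanishing inflow vanishes. With `x = ∫₀ᵗ z`, the weighted energy `⟨λ₀ x, x⟩` is nonincreasing. -/
theorem IsTransportSolution.eq_zero {lam : ℝ → ℝ} (hlam : MemLp lam ∞ spaceMeasure) {ε : ℝ}
    (hε : 0 < ε) (hpos : ∀ᵐ ζ ∂spaceMeasure, ε ≤ lam ζ) {z : ℝ → StateSpace n}
    {w₀ w₁ : ℝ → EuclideanSpace ℂ (Fin n)} (h : IsTransportSolution lam 0 z w₀ w₁)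
    (hw₀ : w₀ =ᵐ[volume.restrict (Ioi (0 : ℝ))] 0) :
    (∀ t, 0 ≤ t → z t = 0) ∧ w₁ =ᵐ[volume.restrict (Ioi (0 : ℝ))] 0 := by
  have hw₀' : ∀ t, 0 ≤ t → ∫ s in (0 : ℝ)..t, w₀ s = 0 := by
    intro t ht
    rw [intervalIntegral.integral_of_le ht]
    refine integral_eq_zero_of_ae ?_
    exact ae_mono (Measure.restrict_mono Ioc_subset_Ioi_self le_rfl) hw₀
  obtain ⟨N, hN⟩ := exists_multiplication_operator (n := n) hlam
  set zc : ℝ → StateSpace n := fun t => z (max t 0) with hzc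
  have hzc_cont : Continuous zc :=
    h.continuousOn.comp_continuous (by fun_prop) fun t => le_max_right t 0
  have hzc_eq : ∀ t, 0 ≤ t → zc t = z t := fun t ht => by simp only [hzc, max_eq_left ht]
  set x : ℝ → StateSpace n := fun t => ∫ s in (0 : ℝ)..t, zc s with hx
  have hx_deriv : ∀ t, HasDerivAt x (zc t) t := fun t =>
    intervalIntegral.integral_hasDerivAt_right (hzc_cont.intervalIntegrable _ _)
      (hzc_cont.stronglyMeasurableAtFilter _ _) hzc_cont.continuousAt
  have hx_eq : ∀ t, 0 ≤ t → x t = ∫ s in (0 : ℝ)..t, z s := fun t ht => by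
    refine intervalIntegral.integral_congr fun s hs => hzc_eq s ?_
    rw [uIcc_of_le ht] at hs
    exact hs.1
  have hneg : ∀ t, ∀ ζ ∈ Icc (0 : ℝ) 1, ∫ s in (0 : ℝ)..ζ, (0 - z t : StateSpace n) s =
      -∫ s in (0 : ℝ)..ζ, z t s := by
    intro t ζ hζ
    rw [← intervalIntegral.integral_neg]
    refine StateSpace.intervalIntegral_congr ?_ hζ
    rw [zero_sub]
    exact Lp.coeFn_neg (z t)
  have hNx : ∀ t, 0 ≤ t → N (x t) =ᵐ[spaceMeasure] fun ζ => -∫ s in (0 : ℝ)..ζ, z t s := by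
    intro t ht
    have h1 := (h.equation t ht).1
    rw [← hx_eq t ht, hw₀' t ht] at h1
    filter_upwards [hN (x t), h1, ae_restrict_mem measurableSet_Ioo] with ζ h2 h3 hζ
    rw [h2, h3, zero_add, hneg t ζ ⟨hζ.1.le, hζ.2.le⟩]
  have hsymm : ∀ a b : StateSpace n, inner ℂ (N a) b = inner ℂ a (N b) := by
    intro a b
    rw [L2.inner_def, L2.inner_def]
    refine integral_congr_ae ?_
    filter_upwards [hN a, hN b] with ζ h1 h2
    rw [h1, h2, inner_smul_left_eq_smul, inner_smul_right_eq_smul]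
  have hcoer : ∀ a : StateSpace n, ε * ‖a‖ ^ 2 ≤ (inner ℂ (N a) a).re := by
    intro a
    have h1 : (inner ℂ (N a) a).re = ∫ ζ, lam ζ * (inner ℂ (a ζ) (a ζ)).re ∂spaceMeasure := by
      rw [L2.inner_def, ← RCLike.re_eq_complex_re, ← integral_re (L2.integrable_inner (N a) a)]
      refine integral_congr_ae ?_
      filter_upwards [hN a] with ζ h1
      rw [h1, inner_smul_left_eq_smul]
      simp
    have hai : Integrable (fun ζ => (inner ℂ (a ζ) (a ζ)).re) spaceMeasure :=
      (L2.integrable_inner (𝕜 := ℂ) a a).re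
    have h2 : ‖a‖ ^ 2 = ∫ ζ, (inner ℂ (a ζ) (a ζ)).re ∂spaceMeasure := by
      rw [← inner_self_eq_norm_sq (𝕜 := ℂ) a, L2.inner_def,
        ← integral_re (L2.integrable_inner a a)]
      rfl
    rw [h1, h2, ← integral_const_mul]
    refine integral_mono_ae (hai.const_mul ε) ?_ ?_
    · have h3 : Integrable (fun ζ => (inner ℂ (N a ζ) (a ζ)).re) spaceMeasure :=
        (L2.integrable_inner (𝕜 := ℂ) (N a) a).re
      refine h3.congr ?_
      filter_upwards [hN a] with ζ h1
      rw [h1, inner_smul_left_eq_smul]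
      simp
    · filter_upwards [hpos] with ζ hζ
      exact mul_le_mul_of_nonneg_right hζ (inner_self_nonneg (𝕜 := ℂ))
  set En : ℝ → ℝ := fun t => (inner ℂ (N (x t)) (x t)).re with hEn
  have hEn_deriv : ∀ t, HasDerivAt En (2 * (inner ℂ (N (x t)) (zc t)).re) t := by
    intro t
    have h1 : HasDerivAt (fun t => N (x t)) (N (zc t)) t :=
      N.hasFDerivAt.comp_hasDerivAt t (hx_deriv t)
    have h2 := h1.inner ℂ (hx_deriv t)
    have h3 := (Complex.reCLM.hasFDerivAt (x := inner ℂ (N (x t)) (x t))).comp_hasDerivAt t h2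
    convert! h3 using 1
    have h4 : (inner ℂ (N (zc t)) (x t)).re = (inner ℂ (N (x t)) (zc t)).re := by
      rw [hsymm, ← inner_conj_symm, Complex.conj_re]
    rw [Complex.reCLM_apply, Complex.add_re, h4, two_mul]
  have hEn_anti : AntitoneOn En (Ici 0) := by
    refine antitoneOn_of_hasDerivWithinAt_nonpos (convex_Ici 0)
      (fun t _ => (hEn_deriv t).continuousAt.continuousWithinAt)
      (fun t _ => (hEn_deriv t).hasDerivWithinAt) fun t ht => ?_
    rw [interior_Ici] at ht
    have ht0 : 0 ≤ t := le_of_lt ht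
    have h1 : (inner ℂ (N (x t)) (zc t)).re =
        -∫ ζ, (inner ℂ (∫ s in (0 : ℝ)..ζ, z t s) (z t ζ)).re ∂spaceMeasure := by
      rw [hzc_eq t ht0, L2.inner_def, ← RCLike.re_eq_complex_re,
        ← integral_re (L2.integrable_inner _ _), ← integral_neg]
      refine integral_congr_ae ?_
      filter_upwards [hNx t ht0] with ζ h2
      rw [h2, inner_neg_left]
      simp
    rw [h1]
    linarith [integral_re_inner_primitive_nonneg (z t)]
  have hx0 : ∀ t, 0 ≤ t → x t = 0 := by
    intro t ht
    have h1 := hEn_anti (mem_Ici.2 le_rfl) (mem_Ici.2 ht) ht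
    have h2 : En 0 = 0 := by simp [hEn, hx]
    have h3 := hcoer (x t)
    have h4 : ε * ‖x t‖ ^ 2 ≤ 0 := h3.trans (h1.trans h2.le)
    have h5 : ‖x t‖ ^ 2 ≤ 0 := by
      by_contra! hlt
      exact absurd (mul_pos hε hlt) (not_lt.2 h4)
    have h6 : ‖x t‖ = 0 := by nlinarith [norm_nonneg (x t)]
    exact norm_eq_zero.1 h6
  have hz0 : ∀ t, 0 ≤ t → z t = 0 := by
    intro t ht
    rw [← hzc_eq t ht]
    have h1 : HasDerivWithinAt x 0 (Ici t) t :=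
      (hasDerivWithinAt_const t (Ici t) (0 : StateSpace n)).congr
        (fun s hs => hx0 s (ht.trans hs)) (hx0 t ht)
    exact (uniqueDiffOn_Ici t t self_mem_Ici).eq_deriv _ (hx_deriv t).hasDerivWithinAt h1
  refine ⟨hz0, ae_eq_zero_of_intervalIntegral_eq_zero h.trace_one fun t ht => ?_⟩
  rw [(h.equation t ht).2, hw₀' t ht, hneg t 1 ⟨zero_le_one, le_rfl⟩, hz0 t ht, zero_add,
    neg_eq_zero]
  rw [StateSpace.intervalIntegral_congr (Lp.coeFn_zero _ _ _) ⟨zero_le_one, le_rfl⟩]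
  simp

theorem IsTransportSolution.unique {lam : ℝ → ℝ} (hlam : MemLp lam ∞ spaceMeasure) {ε : ℝ}
    (hε : 0 < ε) (hpos : ∀ᵐ ζ ∂spaceMeasure, ε ≤ lam ζ) {z₀ : StateSpace n}
    {z z' : ℝ → StateSpace n} {w₀ w₁ w₀' w₁' : ℝ → EuclideanSpace ℂ (Fin n)}
    (h : IsTransportSolution lam z₀ z w₀ w₁) (h' : IsTransportSolution lam z₀ z' w₀' w₁')
    (hw₀ : w₀ =ᵐ[volume.restrict (Ioi (0 : ℝ))] w₀') :
    EqOn z z' (Ici 0) ∧ w₁ =ᵐ[volume.restrict (Ioi (0 : ℝ))] w₁' := by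
  have hsub := h.sub h'
  rw [sub_self] at hsub
  obtain ⟨h1, h2⟩ := hsub.eq_zero hlam hε hpos (by
    filter_upwards [hw₀] with t ht
    simp [ht])
  refine ⟨fun t ht => sub_eq_zero.1 (h1 t ht), ?_⟩
  filter_upwards [h2] with t ht
  exact sub_eq_zero.1 ht

end Transport

/-! ### The travel time as a change of variables -/

/-- An everywhere defined measurable slowness `ρ = λ₀⁻¹` with positive lower and upper bounds. The
transport speed is only prescribed almost everywhere on `(0,1)`; working with such a
representative on the whole line makes the travel time an order isomorphism of `ℝ`. -/
structure Slowness where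
  /-- the slowness -/
  rho : ℝ → ℝ
  /-- lower bound -/
  lo : ℝ
  /-- upper bound -/
  hi : ℝ
  measurable : Measurable rho
  lo_pos : 0 < lo
  lo_le : ∀ s, lo ≤ rho s
  le_hi : ∀ s, rho s ≤ hi

theorem eLpNorm_two_sq {α E : Type*} [MeasurableSpace α] {μ : Measure α} [NormedAddCommGroup E]
    (f : α → E) : eLpNorm f 2 μ ^ 2 = ∫⁻ x, ‖f x‖ₑ ^ 2 ∂μ := by
  have := eLpNorm_nnreal_pow_eq_lintegral (f := f) (μ := μ) (p := 2) (by norm_num)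
  simpa [ENNReal.rpow_ofNat] using this

theorem memLp_two_iff {α E : Type*} [MeasurableSpace α] {μ : Measure α} [NormedAddCommGroup E]
    {f : α → E} (hf : AEStronglyMeasurable f μ) :
    MemLp f 2 μ ↔ ∫⁻ x, ‖f x‖ₑ ^ 2 ∂μ < ∞ := by
  rw [← eLpNorm_two_sq, ENNReal.pow_lt_top_iff]
  simp [MemLp, hf]

/-- `f ∈ L²(a,b)` for all bounded intervals of the real line. -/
def L2LocLine {E : Type*} [NormedAddCommGroup E] (f : ℝ → E) : Prop :=
  ∀ a b : ℝ, MemLp f 2 (volume.restrict (Ioc a b))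

theorem measurePreserving_sub_restrict_Ioc (c a b : ℝ) :
    MeasurePreserving (fun t => t - c) (volume.restrict (Ioc (a + c) (b + c)))
      (volume.restrict (Ioc a b)) := by
  have h := (measurePreserving_sub_right (volume : Measure ℝ) c).restrict_preimage
    (measurableSet_Ioc (a := a) (b := b))
  rwa [preimage_sub_const_Ioc] at h

theorem measurePreserving_const_sub_restrict_Ioc (c a b : ℝ) :
    MeasurePreserving (fun t => c - t) (volume.restrict (Ioc a b))
      (volume.restrict (Ioc (c - b) (c - a))) := by
  have h := (Measure.measurePreserving_sub_left (volume : Measure ℝ) c).restrict_preimage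
    (measurableSet_Ioc (a := c - b) (b := c - a))
  rw [preimage_const_sub_Ioc, sub_sub_cancel, sub_sub_cancel,
    restrict_Ico_eq_restrict_Ioc] at h
  exact h

theorem L2LocLine.comp_sub {E : Type*} [NormedAddCommGroup E] {f : ℝ → E} (hf : L2LocLine f)
    (c : ℝ) : L2LocLine fun t => f (t - c) := by
  intro a b
  have := (hf (a - c) (b - c)).comp_measurePreserving
    (measurePreserving_sub_restrict_Ioc c (a - c) (b - c))
  rw [sub_add_cancel, sub_add_cancel] at this
  exact this

theorem L2LocLine.intervalIntegrable {E : Type*} [NormedAddCommGroup E] {f : ℝ → E}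
    (hf : L2LocLine f) (a b : ℝ) : IntervalIntegrable f volume a b :=
  ⟨(hf a b).integrable (by norm_num), (hf b a).integrable (by norm_num)⟩

namespace Slowness

variable (r : Slowness)

theorem rho_pos (s : ℝ) : 0 < r.rho s := r.lo_pos.trans_le (r.lo_le s)

theorem hi_pos : 0 < r.hi := (r.rho_pos 0).trans_le (r.le_hi 0)

theorem ae_inv_hi_le {lam : ℝ → ℝ} (hlam : ∀ᵐ ζ ∂spaceMeasure, lam ζ * r.rho ζ = 1) :
    ∀ᵐ ζ ∂spaceMeasure, r.hi⁻¹ ≤ lam ζ := by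
  filter_upwards [hlam] with ζ hζ
  rw [eq_inv_of_mul_eq_one_left hζ]
  exact inv_anti₀ (r.rho_pos ζ) (r.le_hi ζ)

theorem intervalIntegrable (a b : ℝ) : IntervalIntegrable r.rho volume a b := by
  refine (intervalIntegrable_const (c := r.hi)).mono_fun r.measurable.aestronglyMeasurable ?_
  refine Filter.Eventually.of_forall fun s => ?_
  simp only [Real.norm_of_nonneg (r.rho_pos s).le, Real.norm_of_nonneg r.hi_pos.le]
  exact r.le_hi s

/-- The travel time from `0` to `ζ`. -/
noncomputable def phi (ζ : ℝ) : ℝ := ∫ s in (0 : ℝ)..ζ, r.rho s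

theorem phi_sub (a b : ℝ) : r.phi b - r.phi a = ∫ s in a..b, r.rho s :=
  intervalIntegral.integral_interval_sub_left (r.intervalIntegrable _ _) (r.intervalIntegrable _ _)

theorem lo_mul_le {a b : ℝ} (hab : a ≤ b) : r.lo * (b - a) ≤ r.phi b - r.phi a := by
  rw [r.phi_sub, mul_comm, ← smul_eq_mul, ← intervalIntegral.integral_const]
  exact intervalIntegral.integral_mono_on hab intervalIntegrable_const (r.intervalIntegrable _ _)
    fun s _ => r.lo_le s

theorem strictMono_phi : StrictMono r.phi := fun a b hab => by
  have := r.lo_mul_le hab.le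
  have := mul_pos r.lo_pos (sub_pos.2 hab)
  linarith

theorem continuous_phi : Continuous r.phi :=
  intervalIntegral.continuous_primitive (fun a b => r.intervalIntegrable a b) 0

@[simp] theorem phi_zero : r.phi 0 = 0 := intervalIntegral.integral_same

theorem surjective_phi : Function.Surjective r.phi := by
  refine r.continuous_phi.surjective ?_ ?_
  · refine Filter.tendsto_atTop_mono' (f₁ := fun x => r.lo * x) _ ?_
      (Filter.tendsto_id.const_mul_atTop r.lo_pos)
    filter_upwards [Filter.eventually_ge_atTop 0] with x hx
    have := r.lo_mul_le hx
    simpa using this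
  · refine Filter.tendsto_atBot_mono' (f₁ := fun x => r.lo * x) _ ?_
      (Filter.tendsto_id.const_mul_atBot r.lo_pos)
    filter_upwards [Filter.eventually_le_atBot 0] with x hx
    have := r.lo_mul_le hx
    simp only [phi_zero, zero_sub] at this
    linarith

/-- The inverse of the travel time: the point reached after a given time. -/
noncomputable def psi : ℝ ≃o ℝ := (StrictMono.orderIsoOfSurjective r.phi r.strictMono_phi r.surjective_phi).symm

theorem psi_phi (ζ : ℝ) : r.psi (r.phi ζ) = ζ :=
  (StrictMono.orderIsoOfSurjective r.phi r.strictMono_phi r.surjective_phi).symm_apply_apply ζ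

/-- The total travel time. -/
noncomputable def tau : ℝ := r.phi 1

theorem tau_pos : 0 < r.tau := by
  have := r.strictMono_phi zero_lt_one
  rwa [phi_zero] at this

theorem phi_mem {ζ : ℝ} (hζ : ζ ∈ Ioo (0 : ℝ) 1) : r.phi ζ ∈ Ioo 0 r.tau := by
  have h1 := r.strictMono_phi hζ.1
  rw [phi_zero] at h1
  exact ⟨h1, r.strictMono_phi hζ.2⟩

theorem measurableEmbedding_phi : MeasurableEmbedding r.phi :=
  r.continuous_phi.measurableEmbedding r.strictMono_phi.injective

theorem preimage_phi_Ioc (a b : ℝ) : r.phi ⁻¹' Ioc (r.phi a) (r.phi b) = Ioc a b := by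
  ext x
  simp [r.strictMono_phi.lt_iff_lt, r.strictMono_phi.le_iff_le]

/-- The travel time transports the measure `ρ dζ` to Lebesgue measure. -/
theorem map_phi : (volume.withDensity fun ζ => ENNReal.ofReal (r.rho ζ)).map r.phi = volume := by
  symm
  refine Measure.ext_of_Ioc' _ _ (fun a b _ => by simp) fun a b hab => ?_
  obtain ⟨a, rfl⟩ := r.surjective_phi a
  obtain ⟨b, rfl⟩ := r.surjective_phi b
  have hab' : a ≤ b := (r.strictMono_phi.lt_iff_lt.1 hab).le
  rw [r.measurableEmbedding_phi.map_apply, r.preimage_phi_Ioc, withDensity_apply _ measurableSet_Ioc,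
    ← ofReal_integral_eq_lintegral_ofReal (r.intervalIntegrable a b).1
      (Filter.Eventually.of_forall fun s => (r.rho_pos s).le),
    ← intervalIntegral.integral_of_le hab', ← r.phi_sub, Real.volume_Ioc]

theorem measurePreserving_phi :
    MeasurePreserving r.phi (volume.withDensity fun ζ => ENNReal.ofReal (r.rho ζ)) volume :=
  ⟨r.continuous_phi.measurable, r.map_phi⟩

theorem lintegral_rho_mul_comp_phi (F : ℝ → ℝ≥0∞) (hF : Measurable F) (a b : ℝ) :
    ∫⁻ ζ in Ioc a b, ENNReal.ofReal (r.rho ζ) * F (r.phi ζ) =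
      ∫⁻ s in Ioc (r.phi a) (r.phi b), F s := by
  have h := r.measurePreserving_phi.setLIntegral_comp_preimage
    (measurableSet_Ioc (a := r.phi a) (b := r.phi b)) hF
  rw [r.preimage_phi_Ioc, restrict_withDensity measurableSet_Ioc,
    lintegral_withDensity_eq_lintegral_mul _ r.measurable.ennreal_ofReal
      (g := fun ζ => F (r.phi ζ)) (hF.comp r.continuous_phi.measurable)] at h
  exact h

/-- Change of variables `s = t - φ(ζ)` in nonnegative integrals. -/
theorem lintegral_rho_mul_comp_sub_phi (F : ℝ → ℝ≥0∞) (hF : Measurable F) (t : ℝ) :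
    ∫⁻ ζ, ENNReal.ofReal (r.rho ζ) * F (t - r.phi ζ) ∂spaceMeasure =
      ∫⁻ s in Ioc (t - r.tau) t, F s := by
  have h := r.lintegral_rho_mul_comp_phi (fun s => F (t - s))
    (hF.comp (measurable_const.sub measurable_id)) 0 1
  rw [← restrict_Ioo_eq_restrict_Ioc, phi_zero] at h
  rw [spaceMeasure, h]
  have h2 := (measurePreserving_const_sub_restrict_Ioc t 0 r.tau).lintegral_comp hF
  rw [sub_zero] at h2
  exact h2

theorem integral_rho_smul_comp_phi {E : Type*} [NormedAddCommGroup E] [NormedSpace ℝ E]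
    (g : ℝ → E) {a b : ℝ} (hab : a ≤ b) :
    ∫ ζ in a..b, r.rho ζ • g (r.phi ζ) = ∫ s in r.phi a..r.phi b, g s := by
  have h := r.measurePreserving_phi.setIntegral_preimage_emb r.measurableEmbedding_phi g
    (Ioc (r.phi a) (r.phi b))
  rw [r.preimage_phi_Ioc, setIntegral_withDensity_eq_setIntegral_toReal_smul
    r.measurable.ennreal_ofReal (Filter.Eventually.of_forall fun _ => ENNReal.ofReal_lt_top) _
    measurableSet_Ioc] at h
  rw [intervalIntegral.integral_of_le hab,
    intervalIntegral.integral_of_le (r.strictMono_phi.monotone hab), ← h]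
  refine integral_congr_ae (Filter.Eventually.of_forall fun ζ => ?_)
  simp only [ENNReal.toReal_ofReal (r.rho_pos ζ).le]

/-- Change of variables `s = t - φ(ζ)` in vector-valued integrals. -/
theorem integral_rho_smul_comp_sub_phi {E : Type*} [NormedAddCommGroup E] [NormedSpace ℝ E]
    (g : ℝ → E) (t : ℝ) {ζ : ℝ} (hζ : 0 ≤ ζ) :
    ∫ η in (0 : ℝ)..ζ, r.rho η • g (t - r.phi η) = ∫ s in (t - r.phi ζ)..t, g s := by
  rw [r.integral_rho_smul_comp_phi (fun s => g (t - s)) hζ, intervalIntegral.integral_comp_sub_left,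
    phi_zero, sub_zero]

/-! ### The travelling wave with prescribed boundary function -/

variable {n : ℕ}

/-- The profile `ζ ↦ ρ(ζ) f(t - φ(ζ))` at time `t` of the wave whose flux `λ₀ z` has the boundary
function `f` at `ζ = 0`. -/
noncomputable def wave (f : ℝ → EuclideanSpace ℂ (Fin n)) (t ζ : ℝ) : EuclideanSpace ℂ (Fin n) :=
  r.rho ζ • f (t - r.phi ζ)

variable {f : ℝ → EuclideanSpace ℂ (Fin n)}

theorem stronglyMeasurable_wave (hf : StronglyMeasurable f) :
    StronglyMeasurable fun q : ℝ × ℝ => r.wave f q.1 q.2 :=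
  (r.measurable.comp measurable_snd).stronglyMeasurable.smul (hf.comp_measurable
    (measurable_fst.sub (r.continuous_phi.measurable.comp measurable_snd)))

theorem stronglyMeasurable_wave_right (hf : StronglyMeasurable f) (t : ℝ) :
    StronglyMeasurable (r.wave f t) :=
  r.measurable.stronglyMeasurable.smul (hf.comp_measurable
    (measurable_const.sub r.continuous_phi.measurable))

theorem lintegral_wave_le (hf : StronglyMeasurable f) (t : ℝ) :
    ∫⁻ ζ, ‖r.wave f t ζ‖ₑ ^ 2 ∂spaceMeasure ≤
      ENNReal.ofReal r.hi * ∫⁻ s in Ioc (t - r.tau) t, ‖f s‖ₑ ^ 2 := by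
  have hm : Measurable fun s => ‖f s‖ₑ ^ 2 := hf.enorm.pow_const 2
  rw [← r.lintegral_rho_mul_comp_sub_phi _ hm, ← lintegral_const_mul' _ _ ENNReal.ofReal_ne_top]
  refine lintegral_mono fun ζ => ?_
  rw [wave, enorm_smul, mul_pow, ← mul_assoc, Real.enorm_eq_ofReal (r.rho_pos ζ).le, sq]
  gcongr
  exact r.le_hi ζ

theorem lintegral_le_lintegral_wave (hf : StronglyMeasurable f) (t : ℝ) :
    ENNReal.ofReal r.lo * ∫⁻ s in Ioc (t - r.tau) t, ‖f s‖ₑ ^ 2 ≤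
      ∫⁻ ζ, ‖r.wave f t ζ‖ₑ ^ 2 ∂spaceMeasure := by
  have hm : Measurable fun s => ‖f s‖ₑ ^ 2 := hf.enorm.pow_const 2
  rw [← r.lintegral_rho_mul_comp_sub_phi _ hm, ← lintegral_const_mul' _ _ ENNReal.ofReal_ne_top]
  refine lintegral_mono fun ζ => ?_
  rw [wave, enorm_smul, mul_pow, ← mul_assoc, Real.enorm_eq_ofReal (r.rho_pos ζ).le,
    sq (ENNReal.ofReal (r.rho ζ))]
  gcongr
  exact r.lo_le ζ

theorem memLp_wave (hf : StronglyMeasurable f) (hf2 : L2LocLine f) (t : ℝ) :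
    MemLp (r.wave f t) 2 spaceMeasure := by
  rw [memLp_two_iff (r.stronglyMeasurable_wave_right hf t).aestronglyMeasurable]
  refine (r.lintegral_wave_le hf t).trans_lt (ENNReal.mul_lt_top ENNReal.ofReal_lt_top ?_)
  rw [← memLp_two_iff hf.aestronglyMeasurable]
  exact hf2 _ _

/-- The state at time `t` of the wave with boundary function `f`. -/
noncomputable def state (hf : StronglyMeasurable f) (hf2 : L2LocLine f) (t : ℝ) : StateSpace n :=
  (r.memLp_wave hf hf2 t).toLp _

theorem coeFn_state (hf : StronglyMeasurable f) (hf2 : L2LocLine f) (t : ℝ) :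
    r.state hf hf2 t =ᵐ[spaceMeasure] r.wave f t :=
  MemLp.coeFn_toLp _

theorem enorm_state_sq (hf : StronglyMeasurable f) (hf2 : L2LocLine f) (t : ℝ) :
    ‖r.state hf hf2 t‖ₑ ^ 2 = ∫⁻ ζ, ‖r.wave f t ζ‖ₑ ^ 2 ∂spaceMeasure := by
  rw [state, Lp.enorm_toLp, eLpNorm_two_sq]

end Slowness

/-- Translations act strongly continuously on `L²(ℝ)`. -/
theorem tendsto_eLpNorm_translate_sub {E : Type*} [NormedAddCommGroup E] {g : ℝ → E}
    (hg : MemLp g 2 volume) (t₀ : ℝ) :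
    Filter.Tendsto (fun t => eLpNorm (fun s => g (t + s) - g (t₀ + s)) 2 volume) (nhds t₀)
      (nhds 0) := by
  have hmp : ∀ t : ℝ, MeasurePreserving (ContinuousMap.mk (fun s : ℝ => t + s)) volume volume :=
    fun t => measurePreserving_add_left volume t
  have hcont : Continuous fun t : ℝ => ContinuousMap.mk (fun s : ℝ => t + s) :=
    ContinuousMap.continuous_of_continuous_uncurry _ continuous_add
  have h := (continuous_const (y := hg.toLp g)).compMeasurePreservingLp hcont hmp (by norm_num)
  have h2 := (continuous_enorm.comp (h.sub (continuous_const
    (y := Lp.compMeasurePreserving _ (hmp t₀) (hg.toLp g))))).tendsto t₀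
  simp only [Function.comp_def, Pi.sub_apply, sub_self, enorm_zero] at h2
  refine h2.congr fun t => ?_
  rw [Lp.toLp_compMeasurePreserving, Lp.toLp_compMeasurePreserving, ← MemLp.toLp_sub,
    Lp.enorm_toLp]
  rfl

namespace Slowness

variable (r : Slowness) {n : ℕ} {f : ℝ → EuclideanSpace ℂ (Fin n)}

theorem continuous_state (hf : StronglyMeasurable f) (hf2 : L2LocLine f) :
    Continuous (r.state hf hf2) := by
  refine continuous_iff_continuousAt.2 fun t₀ => ?_
  -- Near `t₀` only the values of `f` on a bounded interval matter.
  set g : ℝ → EuclideanSpace ℂ (Fin n) := (Ioc (t₀ - r.tau - 1) (t₀ + 1)).indicator f with hg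
  have hgm : StronglyMeasurable g := hf.indicator measurableSet_Ioc
  have hg2 : MemLp g 2 volume := (memLp_indicator_iff_restrict measurableSet_Ioc).2 (hf2 _ _)
  have hwave : ∀ t ∈ Metric.ball t₀ 1, ∀ ζ ∈ Ioo (0 : ℝ) 1, r.wave f t ζ = r.wave g t ζ := by
    intro t ht ζ hζ
    have h1 := r.phi_mem hζ
    rw [Real.ball_eq_Ioo] at ht
    rw [wave, wave, hg, indicator_of_mem]
    exact ⟨by linarith [ht.1, h1.2], by linarith [ht.2, h1.1]⟩
  have hbound : ∀ t ∈ Metric.ball t₀ 1, ‖r.state hf hf2 t - r.state hf hf2 t₀‖ₑ ^ 2 ≤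
      ENNReal.ofReal r.hi * eLpNorm (fun s => g (t + s) - g (t₀ + s)) 2 volume ^ 2 := by
    intro t ht
    have hd : StronglyMeasurable fun s => g (t + s) - g (t₀ + s) :=
      (hgm.comp_measurable (measurable_const.add measurable_id)).sub
        (hgm.comp_measurable (measurable_const.add measurable_id))
    rw [state, state, ← MemLp.toLp_sub, Lp.enorm_toLp, eLpNorm_two_sq, eLpNorm_two_sq]
    calc ∫⁻ ζ, ‖(r.wave f t - r.wave f t₀) ζ‖ₑ ^ 2 ∂spaceMeasure
        = ∫⁻ ζ, ‖r.wave (fun s => g (t + s) - g (t₀ + s)) 0 ζ‖ₑ ^ 2 ∂spaceMeasure := by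
          refine lintegral_congr_ae ?_
          filter_upwards [ae_restrict_mem measurableSet_Ioo] with ζ hζ
          rw [Pi.sub_apply, hwave t ht ζ hζ, hwave t₀ (Metric.mem_ball_self one_pos) ζ hζ]
          simp only [wave, zero_sub, smul_sub, ← sub_eq_add_neg]
      _ ≤ _ := r.lintegral_wave_le hd 0
      _ ≤ _ := by
          gcongr
          exact Measure.restrict_le_self
  have hlim : Filter.Tendsto (fun t => ENNReal.ofReal r.hi *
      eLpNorm (fun s => g (t + s) - g (t₀ + s)) 2 volume ^ 2) (nhds t₀) (nhds 0) := by
    have h1 := (ENNReal.continuous_pow 2).tendsto 0 |>.comp (tendsto_eLpNorm_translate_sub hg2 t₀)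
    have h2 := ENNReal.Tendsto.const_mul (a := ENNReal.ofReal r.hi) h1
      (Or.inr ENNReal.ofReal_ne_top)
    simpa using h2
  have hsq : Filter.Tendsto (fun t => ‖r.state hf hf2 t - r.state hf hf2 t₀‖ₑ ^ 2) (nhds t₀)
      (nhds 0) :=
    tendsto_of_tendsto_of_tendsto_of_le_of_le' tendsto_const_nhds hlim
      (Filter.Eventually.of_forall fun _ => zero_le)
      (Filter.eventually_of_mem (Metric.ball_mem_nhds t₀ one_pos) hbound)
  have hreal := (ENNReal.tendsto_toReal ENNReal.zero_ne_top).comp hsq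
  have hsqrt := (Real.continuous_sqrt.tendsto 0).comp hreal
  rw [ContinuousAt, tendsto_iff_norm_sub_tendsto_zero]
  simpa [Function.comp_def, Real.sqrt_sq] using hsqrt

end Slowness

/-- A Bochner integral with values in `L²` is computed pointwise. -/
theorem Lp.coeFn_integral {α E : Type*} [MeasurableSpace α] {μ : Measure α} [IsFiniteMeasure μ]
    [NormedAddCommGroup E] [InnerProductSpace ℂ E] [CompleteSpace E]
    {ν : Measure ℝ} [IsFiniteMeasure ν] {z : ℝ → Lp E 2 μ} (hz : Integrable z ν)
    {G : ℝ → α → E} (hzG : ∀ s, z s =ᵐ[μ] G s)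
    (hG : Integrable (Function.uncurry G) (ν.prod μ)) :
    (∫ s, z s ∂ν : Lp E 2 μ) =ᵐ[μ] fun ζ => ∫ s, G s ζ ∂ν := by
  refine Integrable.ae_eq_of_forall_setIntegral_eq _ _ ((Lp.memLp _).integrable (by norm_num))
    hG.integral_prod_right fun A hA hAμ => ?_
  refine ext_inner_left ℂ fun c => ?_
  have hGA : Integrable (Function.uncurry G) (ν.prod (μ.restrict A)) := by
    refine hG.mono_measure ?_
    exact Measure.prod_mono le_rfl Measure.restrict_le_self
  rw [← L2.inner_indicatorConstLp_eq_inner_setIntegral ℂ hA hAμ.ne c, ← integral_inner hz,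
    ← integral_integral_swap hGA,
    ← integral_inner (f := fun s => ∫ ζ in A, G s ζ ∂μ) hGA.integral_prod_left]
  refine integral_congr_ae (Filter.Eventually.of_forall fun s => ?_)
  simp only
  rw [L2.inner_indicatorConstLp_eq_inner_setIntegral ℂ hA hAμ.ne c]
  congr 1
  exact integral_congr_ae (ae_restrict_of_ae (hzG s))

namespace Slowness

variable (r : Slowness) {n : ℕ} {f : ℝ → EuclideanSpace ℂ (Fin n)}

theorem integrable_wave (hf : StronglyMeasurable f) (hf2 : L2LocLine f) (t : ℝ) :
    Integrable (Function.uncurry (r.wave f)) ((volume.restrict (Ioc 0 t)).prod spaceMeasure) := by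
  refine ⟨(r.stronglyMeasurable_wave hf).aestronglyMeasurable, ?_⟩
  have hm : Measurable fun q : ℝ × ℝ => ‖Function.uncurry (r.wave f) q‖ₑ :=
    (r.stronglyMeasurable_wave hf).enorm
  rw [hasFiniteIntegral_iff_enorm, lintegral_prod _ hm.aemeasurable]
  simp only [Function.uncurry_apply_pair]
  have h1 : ∀ s, ∫⁻ ζ, ‖r.wave f s ζ‖ₑ ∂spaceMeasure = ∫⁻ σ in Ioc (s - r.tau) s, ‖f σ‖ₑ := by
    intro s
    rw [← r.lintegral_rho_mul_comp_sub_phi _ hf.enorm]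
    refine lintegral_congr fun ζ => ?_
    rw [wave, enorm_smul, Real.enorm_eq_ofReal (r.rho_pos ζ).le]
  have h2 : ∫⁻ σ in Ioc (-r.tau) t, ‖f σ‖ₑ < ∞ :=
    ((hf2 (-r.tau) t).integrable (by norm_num)).2
  calc ∫⁻ s in Ioc 0 t, ∫⁻ ζ, ‖r.wave f s ζ‖ₑ ∂spaceMeasure
      ≤ ∫⁻ s in Ioc 0 t, ∫⁻ σ in Ioc (-r.tau) t, ‖f σ‖ₑ := by
        refine setLIntegral_mono' measurableSet_Ioc fun s hs => ?_
        rw [h1]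
        exact lintegral_mono_set (Ioc_subset_Ioc (by linarith [hs.1]) hs.2)
    _ < ∞ := by
        rw [lintegral_const]
        exact ENNReal.mul_lt_top h2 (by simp)

/-- The travelling wave with boundary function `f` solves the transport equation; its flux has the
boundary values `f` at `ζ = 0` and `f(· - τ)` at `ζ = 1`. -/
theorem isTransportSolution_state (hf : StronglyMeasurable f) (hf2 : L2LocLine f) {lam : ℝ → ℝ}
    (hlam : ∀ᵐ ζ ∂spaceMeasure, lam ζ * r.rho ζ = 1) :
    IsTransportSolution lam (r.state hf hf2 0) (r.state hf hf2) f (fun t => f (t - r.tau)) where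
  continuousOn := (r.continuous_state hf hf2).continuousOn
  init := rfl
  trace_zero T := hf2 0 T
  trace_one T := hf2.comp_sub r.tau 0 T
  equation t ht := by
    have hint := hf2.intervalIntegrable
    have hrhs : ∀ ζ ∈ Icc (0 : ℝ) 1, (∫ s in (0 : ℝ)..t, f s) +
        ∫ s in (0 : ℝ)..ζ, (r.state hf hf2 0 - r.state hf hf2 t : StateSpace n) s =
        ∫ s in (0 : ℝ)..t, f (s - r.phi ζ) := by
      intro ζ hζ
      have h1 : ∫ s in (0 : ℝ)..ζ, (r.state hf hf2 0 - r.state hf hf2 t : StateSpace n) s =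
          (∫ s in (0 - r.phi ζ)..0, f s) - ∫ s in (t - r.phi ζ)..t, f s := by
        rw [StateSpace.intervalIntegral_congr (Lp.coeFn_sub _ _) hζ]
        simp only [Pi.sub_apply]
        rw [intervalIntegral.integral_sub (StateSpace.intervalIntegrable _ hζ)
            (StateSpace.intervalIntegrable _ hζ),
          StateSpace.intervalIntegral_congr (r.coeFn_state hf hf2 0) hζ,
          StateSpace.intervalIntegral_congr (r.coeFn_state hf hf2 t) hζ]
        simp only [wave]
        rw [r.integral_rho_smul_comp_sub_phi f 0 hζ.1, r.integral_rho_smul_comp_sub_phi f t hζ.1]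
      rw [h1, intervalIntegral.integral_comp_sub_right]
      have h2 := intervalIntegral.integral_add_adjacent_intervals (hint (0 - r.phi ζ) 0) (hint 0 t)
      have h3 := intervalIntegral.integral_add_adjacent_intervals
        (hint (0 - r.phi ζ) (t - r.phi ζ)) (hint (t - r.phi ζ) t)
      rw [← h3] at h2
      rw [← add_sub_assoc, add_comm, h2, add_sub_cancel_right]
    refine ⟨?_, ?_⟩
    · have hcoe := Lp.coeFn_integral (ν := volume.restrict (Ioc 0 t))
        (((r.continuous_state hf hf2).intervalIntegrable 0 t).1) (G := r.wave f)
        (r.coeFn_state hf hf2) (r.integrable_wave hf hf2 t)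
      rw [intervalIntegral.integral_of_le ht (f := fun s => r.state hf hf2 s)]
      filter_upwards [hcoe, hlam, ae_restrict_mem measurableSet_Ioo] with ζ h1 h2 hζ
      rw [h1, hrhs ζ ⟨hζ.1.le, hζ.2.le⟩, intervalIntegral.integral_of_le ht]
      simp only [wave]
      rw [integral_smul, smul_smul, h2, one_smul]
    · rw [hrhs 1 ⟨zero_le_one, le_rfl⟩]
      rfl

end Slowness

/-! ### Boundary functions and the delay relation between the traces -/

namespace Slowness

variable (r : Slowness) {n : ℕ}

/-- The boundary function on `(-τ, 0]` of the wave with initial state `z₀`: the values of the flux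
that `z₀` carries, labelled by the (negative) time at which they would have entered at `ζ = 0`. -/
noncomputable def history (z₀ : StateSpace n) : ℝ → EuclideanSpace ℂ (Fin n) :=
  (Ioc (-r.tau) 0).indicator fun t => (r.rho (r.psi (-t)))⁻¹ • z₀ (r.psi (-t))

theorem stronglyMeasurable_history (z₀ : StateSpace n) : StronglyMeasurable (r.history z₀) := by
  have hpsi : Measurable fun t => r.psi (-t) := r.psi.continuous.measurable.comp measurable_neg
  exact ((r.measurable.comp hpsi).inv.stronglyMeasurable.smul
    ((Lp.stronglyMeasurable z₀).comp_measurable hpsi)).indicator measurableSet_Ioc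

theorem wave_zero_of_eq_history {z₀ : StateSpace n} {f : ℝ → EuclideanSpace ℂ (Fin n)}
    (h : ∀ t ≤ 0, f t = r.history z₀ t) {ζ : ℝ} (hζ : ζ ∈ Ioo (0 : ℝ) 1) :
    r.wave f 0 ζ = z₀ ζ := by
  have h1 := r.phi_mem hζ
  have hmem : -r.phi ζ ∈ Ioc (-r.tau) 0 := ⟨by linarith [h1.2], by linarith [h1.1]⟩
  rw [wave, zero_sub, h _ (by linarith [h1.1]), history, indicator_of_mem hmem, neg_neg, r.psi_phi,
    smul_inv_smul₀ (r.rho_pos ζ).ne']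

theorem lintegral_history_le (z₀ : StateSpace n) :
    ENNReal.ofReal r.lo * ∫⁻ s in Ioc (-r.tau) 0, ‖r.history z₀ s‖ₑ ^ 2 ≤ ‖z₀‖ₑ ^ 2 := by
  have h := r.lintegral_le_lintegral_wave (r.stronglyMeasurable_history z₀) 0
  rw [zero_sub] at h
  refine h.trans_eq ?_
  rw [Lp.enorm_def, eLpNorm_two_sq]
  refine lintegral_congr_ae ?_
  filter_upwards [ae_restrict_mem measurableSet_Ioo] with ζ hζ
  rw [r.wave_zero_of_eq_history (fun t _ => rfl) hζ]

theorem memLp_history (z₀ : StateSpace n) : MemLp (r.history z₀) 2 volume := by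
  have hlo : ENNReal.ofReal r.lo ≠ 0 := by simpa using r.lo_pos
  have h1 : MemLp (r.history z₀) 2 (volume.restrict (Ioc (-r.tau) 0)) := by
    rw [memLp_two_iff (r.stronglyMeasurable_history z₀).aestronglyMeasurable]
    have h := (r.lintegral_history_le z₀).trans_lt
      (ENNReal.pow_lt_top (enorm_lt_top (x := z₀)) (n := 2))
    by_contra htop
    rw [not_lt, top_le_iff] at htop
    rw [htop, ENNReal.mul_top hlo] at h
    exact lt_irrefl _ h
  have h2 := (memLp_indicator_iff_restrict measurableSet_Ioc).2 h1
  rwa [history, indicator_indicator, inter_self] at h2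

end Slowness

theorem L2Loc.aestronglyMeasurable {k : ℕ} {w : ℝ → EuclideanSpace ℂ (Fin k)} (hw : L2Loc w) :
    AEStronglyMeasurable w (volume.restrict (Ioi (0 : ℝ))) := by
  have h : Ioi (0 : ℝ) = ⋃ N : ℕ, Ioc 0 (N : ℝ) := by
    ext t
    simp only [mem_Ioi, mem_iUnion, mem_Ioc]
    exact ⟨fun ht => (exists_nat_ge t).imp fun N hN => ⟨ht, hN⟩, fun ⟨N, h⟩ => h.1⟩
  rw [h, aestronglyMeasurable_iUnion_iff]
  exact fun N => (hw N).1

namespace Slowness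

variable (r : Slowness) {n : ℕ} {lam : ℝ → ℝ}

/-- The history of an initial state extends by any `L²_loc` inflow to a measurable locally square
integrable function on the real line. -/
theorem exists_boundaryFunction (z₀ : StateSpace n) {w : ℝ → EuclideanSpace ℂ (Fin n)}
    (hw : L2Loc w) : ∃ f : ℝ → EuclideanSpace ℂ (Fin n), StronglyMeasurable f ∧ L2LocLine f ∧
      (∀ t ≤ 0, f t = r.history z₀ t) ∧ f =ᵐ[volume.restrict (Ioi (0 : ℝ))] w := by
  obtain ⟨w', hw', hww'⟩ := hw.aestronglyMeasurable
  refine ⟨fun t => r.history z₀ t + (Ioi 0).indicator w' t,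
    (r.stronglyMeasurable_history z₀).add (hw'.indicator measurableSet_Ioi), fun a b => ?_,
    fun t ht => ?_, ?_⟩
  · refine ((r.memLp_history z₀).restrict _).add ?_
    rw [memLp_indicator_iff_restrict measurableSet_Ioi, Measure.restrict_restrict measurableSet_Ioi]
    have h1 : MemLp w' 2 (volume.restrict (Ioc 0 b)) := (hw b).ae_eq
      (ae_mono (Measure.restrict_mono Ioc_subset_Ioi_self le_rfl) hww')
    exact h1.mono_measure (Measure.restrict_mono
      (show Ioi 0 ∩ Ioc a b ⊆ Ioc 0 b from fun t ht => ⟨ht.1, ht.2.2⟩) le_rfl)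
  · have hmem : t ∉ Ioi (0 : ℝ) := not_lt.2 ht
    simp only [indicator_of_notMem hmem, add_zero]
  · filter_upwards [hww', ae_restrict_mem measurableSet_Ioi] with t h1 h2
    rw [indicator_of_mem h2, h1, history, indicator_of_notMem fun h => not_lt.2 h.2 h2, zero_add]

theorem isTransportSolution_of_eq_history (hlam : ∀ᵐ ζ ∂spaceMeasure, lam ζ * r.rho ζ = 1)
    {z₀ : StateSpace n} {f : ℝ → EuclideanSpace ℂ (Fin n)} (hf : StronglyMeasurable f)
    (hf2 : L2LocLine f) (h : ∀ t ≤ 0, f t = r.history z₀ t) :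
    IsTransportSolution lam z₀ (r.state hf hf2) f (fun t => f (t - r.tau)) := by
  have h0 : r.state hf hf2 0 = z₀ := by
    refine Lp.ext ?_
    filter_upwards [r.coeFn_state hf hf2 0, ae_restrict_mem measurableSet_Ioo] with ζ h1 h2
    rw [h1, r.wave_zero_of_eq_history h h2]
  have := r.isTransportSolution_state hf hf2 hlam
  rwa [h0] at this

end Slowness

/-- Every mild solution of the transport equation is a travelling wave. -/
theorem IsTransportSolution.exists_eq_state {n : ℕ} {lam : ℝ → ℝ} {z₀ : StateSpace n}
    {z : ℝ → StateSpace n} {w₀ w₁ : ℝ → EuclideanSpace ℂ (Fin n)}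
    (h : IsTransportSolution lam z₀ z w₀ w₁) (r : Slowness)
    (hlamp : MemLp lam ∞ spaceMeasure) (hlam : ∀ᵐ ζ ∂spaceMeasure, lam ζ * r.rho ζ = 1) :
    ∃ (f : ℝ → EuclideanSpace ℂ (Fin n)) (hf : StronglyMeasurable f) (hf2 : L2LocLine f),
      (∀ t ≤ 0, f t = r.history z₀ t) ∧ f =ᵐ[volume.restrict (Ioi (0 : ℝ))] w₀ ∧
        EqOn z (r.state hf hf2) (Ici 0) ∧
          w₁ =ᵐ[volume.restrict (Ioi (0 : ℝ))] fun t => f (t - r.tau) := by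
  obtain ⟨f, hf, hf2, hhist, hfw⟩ := r.exists_boundaryFunction z₀ h.trace_zero
  have hu := h.unique hlamp (inv_pos.2 r.hi_pos) (r.ae_inv_hi_le hlam)
    (r.isTransportSolution_of_eq_history hlam hf hf2 hhist) hfw.symm
  exact ⟨f, hf, hf2, hhist, hfw, hu.1, hu.2⟩

/-! ### Cutting the half line into periods -/

theorem restrict_Ioi_eq_sum_map {τ : ℝ} (hτ : 0 < τ) : volume.restrict (Ioi (0 : ℝ)) =
    Measure.sum fun k : ℕ => (volume.restrict (Ioc 0 τ)).map fun s => s + k * τ := by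
  have hU : Ioi (0 : ℝ) = ⋃ k : ℕ, Ioc (0 + (k : ℝ) * τ) (τ + (k : ℝ) * τ) := by
    ext t
    simp only [mem_Ioi, mem_iUnion, mem_Ioc, zero_add]
    constructor
    · intro ht
      have hpos : 0 < ⌈t / τ⌉₊ := Nat.ceil_pos.2 (div_pos ht hτ)
      have h1 := Nat.le_ceil (t / τ)
      have h2 := Nat.ceil_lt_add_one (div_pos ht hτ).le
      have h3 : ((⌈t / τ⌉₊ - 1 : ℕ) : ℝ) = (⌈t / τ⌉₊ : ℝ) - 1 := by
        rw [Nat.cast_sub hpos, Nat.cast_one]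
      refine ⟨⌈t / τ⌉₊ - 1, ?_, ?_⟩
      · rw [h3, ← lt_div_iff₀ hτ]; linarith
      · rw [h3]
        rw [div_le_iff₀ hτ] at h1
        linarith
    · rintro ⟨k, hk, _⟩
      exact lt_of_le_of_lt (by positivity) hk
  have hdisj : Pairwise (Function.onFun Disjoint
      fun k : ℕ => Ioc (0 + (k : ℝ) * τ) (τ + (k : ℝ) * τ)) := by
    have key : ∀ i j : ℕ, i < j →
        Disjoint (Ioc (0 + (i : ℝ) * τ) (τ + (i : ℝ) * τ))
          (Ioc (0 + (j : ℝ) * τ) (τ + (j : ℝ) * τ)) := by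
      intro i j hij
      rw [Set.disjoint_left]
      intro t ht ht'
      have h1 : (i : ℝ) + 1 ≤ j := by exact_mod_cast hij
      have := mul_le_mul_of_nonneg_right h1 hτ.le
      linarith [ht.2, ht'.1]
    intro i j hij
    rcases lt_or_gt_of_ne hij with h | h
    · exact key i j h
    · exact (key j i h).symm
  rw [hU, Measure.restrict_iUnion hdisj fun k => measurableSet_Ioc]
  congr 1
  funext k
  have h := (measurePreserving_add_right (volume : Measure ℝ) ((k : ℝ) * τ)).restrict_preimage
    (measurableSet_Ioc (a := 0 + (k : ℝ) * τ) (b := τ + (k : ℝ) * τ))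
  rw [preimage_add_const_Ioc, add_sub_cancel_right, add_sub_cancel_right] at h
  exact h.map_eq.symm

theorem ae_restrict_Ioi_iff {τ : ℝ} (hτ : 0 < τ) {P : ℝ → Prop} :
    (∀ᵐ t ∂(volume.restrict (Ioi (0 : ℝ))), P t) ↔
      ∀ᵐ s ∂(volume.restrict (Ioc 0 τ)), ∀ k : ℕ, P (s + k * τ) := by
  rw [restrict_Ioi_eq_sum_map hτ, Measure.ae_sum_iff, ae_all_iff]
  exact forall_congr' fun k => (measurableEmbedding_addRight ((k : ℝ) * τ)).ae_map_iff

theorem lintegral_Ioi_eq {τ : ℝ} (hτ : 0 < τ) {F : ℝ → ℝ≥0∞}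
    (hF : AEMeasurable F (volume.restrict (Ioi (0 : ℝ)))) :
    ∫⁻ t in Ioi (0 : ℝ), F t = ∫⁻ s in Ioc 0 τ, ∑' k : ℕ, F (s + k * τ) := by
  have hme : ∀ k : ℕ, MeasurableEmbedding fun s : ℝ => s + k * τ := fun k =>
    measurableEmbedding_addRight ((k : ℝ) * τ)
  rw [restrict_Ioi_eq_sum_map hτ] at hF ⊢
  rw [lintegral_sum_measure, lintegral_tsum fun k => ?_]
  · exact tsum_congr fun k => (hme k).lintegral_map F
  · exact (hF.mono_measure (Measure.le_sum _ k)).comp_measurable (hme k).measurable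

/-- The outflow during the first travel time is the flux of the initial state, and from then on it
is the inflow delayed by the travel time. -/
theorem IsTransportSolution.ae_traces {n : ℕ} {lam : ℝ → ℝ} {z₀ : StateSpace n}
    {z : ℝ → StateSpace n} {w₀ w₁ : ℝ → EuclideanSpace ℂ (Fin n)}
    (h : IsTransportSolution lam z₀ z w₀ w₁) (r : Slowness)
    (hlamp : MemLp lam ∞ spaceMeasure) (hlam : ∀ᵐ ζ ∂spaceMeasure, lam ζ * r.rho ζ = 1) :
    ∀ᵐ s ∂(volume.restrict (Ioc 0 r.tau)), w₁ s = r.history z₀ (s - r.tau) ∧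
      ∀ k : ℕ, w₁ (s + (k + 1 : ℕ) * r.tau) = w₀ (s + k * r.tau) := by
  obtain ⟨f, hf, hf2, hhist, hfw, -, hw₁⟩ := h.exists_eq_state r hlamp hlam
  filter_upwards [(ae_restrict_Ioi_iff r.tau_pos).1 hfw, (ae_restrict_Ioi_iff r.tau_pos).1 hw₁,
    ae_restrict_mem measurableSet_Ioc] with s h1 h2 hs
  refine ⟨?_, fun k => ?_⟩
  · have := h2 0
    rw [Nat.cast_zero, zero_mul, add_zero] at this
    rw [this, hhist _ (by linarith [hs.2])]
  · rw [h2, ← h1]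
    congr 1
    push_cast
    ring

theorem Slowness.lintegral_history_shift {n : ℕ} (r : Slowness) (z₀ : StateSpace n) :
    ∫⁻ s in Ioc 0 r.tau, ‖r.history z₀ (s - r.tau)‖ₑ ^ 2 =
      ∫⁻ s in Ioc (-r.tau) 0, ‖r.history z₀ s‖ₑ ^ 2 := by
  have h := measurePreserving_sub_restrict_Ioc r.tau (-r.tau) 0
  rw [neg_add_cancel, zero_add] at h
  exact h.lintegral_comp (f := fun s => ‖r.history z₀ s‖ₑ ^ 2)
    ((r.stronglyMeasurable_history z₀).enorm.pow_const 2)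

theorem Slowness.ae_history_zero {n : ℕ} (r : Slowness) :
    ∀ᵐ s ∂(volume.restrict (Ioc 0 r.tau)), r.history (0 : StateSpace n) (s - r.tau) = 0 := by
  have hlo : ENNReal.ofReal r.lo ≠ 0 := by simpa using r.lo_pos
  have h := r.lintegral_history_le (0 : StateSpace n)
  rw [← r.lintegral_history_shift, enorm_zero, zero_pow two_ne_zero, nonpos_iff_eq_zero,
    mul_eq_zero, or_iff_right hlo, lintegral_eq_zero_iff] at h
  · filter_upwards [h] with s hs
    simpa using hs
  · exact (((r.stronglyMeasurable_history 0).comp_measurable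
      (measurable_id.sub_const _)).enorm.pow_const 2)

/-! ### Well-posedness of the transport equation with boundary feedback -/

section Feedback

variable {n : ℕ} {lam : ℝ → ℝ}

theorem L2Loc.toEuclideanLin {m k : ℕ} (M : Matrix (Fin m) (Fin k) ℂ)
    {w : ℝ → EuclideanSpace ℂ (Fin k)} (hw : L2Loc w) :
    L2Loc fun t => M.toEuclideanLin (w t) := fun T =>
  (LinearMap.toContinuousLinearMap M.toEuclideanLin).comp_memLp' (hw T)

/-- For every inflow law `w₀ = A w₁ + g` the transport equation has at most one solution. -/
theorem IsTransportSolution.unique_of_feedback (r : Slowness) (hlamp : MemLp lam ∞ spaceMeasure)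
    (hlam : ∀ᵐ ζ ∂spaceMeasure, lam ζ * r.rho ζ = 1) {A : Matrix (Fin n) (Fin n) ℂ}
    {g : ℝ → EuclideanSpace ℂ (Fin n)} {z₀ : StateSpace n} {z z' : ℝ → StateSpace n}
    {w₀ w₁ w₀' w₁' : ℝ → EuclideanSpace ℂ (Fin n)}
    (h : IsTransportSolution lam z₀ z w₀ w₁) (h' : IsTransportSolution lam z₀ z' w₀' w₁')
    (hA : ∀ᵐ t ∂(volume.restrict (Ioi (0 : ℝ))), w₀ t = A.toEuclideanLin (w₁ t) + g t)
    (hA' : ∀ᵐ t ∂(volume.restrict (Ioi (0 : ℝ))), w₀' t = A.toEuclideanLin (w₁' t) + g t) :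
    EqOn z z' (Ici 0) ∧ w₀ =ᵐ[volume.restrict (Ioi (0 : ℝ))] w₀' ∧
      w₁ =ᵐ[volume.restrict (Ioi (0 : ℝ))] w₁' := by
  have hsub := h.sub h'
  rw [sub_self] at hsub
  have h1 : w₁ =ᵐ[volume.restrict (Ioi (0 : ℝ))] w₁' := by
    refine (ae_restrict_Ioi_iff r.tau_pos).2 ?_
    filter_upwards [hsub.ae_traces r hlamp hlam, r.ae_history_zero,
      (ae_restrict_Ioi_iff r.tau_pos).1 hA, (ae_restrict_Ioi_iff r.tau_pos).1 hA']
      with s hs hs0 hsA hsA' k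
    induction k with
    | zero =>
      have := hs.1
      rw [hs0, Pi.sub_apply, sub_eq_zero] at this
      simpa using this
    | succ k ih =>
      have := hs.2 k
      rw [Pi.sub_apply, Pi.sub_apply, hsA, hsA', ih, sub_self, sub_eq_zero] at this
      exact this
  have h0 : w₀ =ᵐ[volume.restrict (Ioi (0 : ℝ))] w₀' := by
    filter_upwards [h1, hA, hA'] with t h1 h2 h3
    rw [h2, h3, h1]
  exact ⟨(h.unique hlamp (inv_pos.2 r.hi_pos) (r.ae_inv_hi_le hlam) h' h0).1, h0, h1⟩

/-- The delay equation `f(t) = A f(t - τ) + g(t)` with history supported in `(-τ, 0]` is solved by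
the locally finite sum `f(t) = ∑ₖ Aᵏ g(t - kτ)`. -/
theorem exists_delay_solution {τ : ℝ} (hτ : 0 < τ) (A : Matrix (Fin n) (Fin n) ℂ)
    {g : ℝ → EuclideanSpace ℂ (Fin n)} (hg : StronglyMeasurable g) (hg2 : L2LocLine g)
    (hg0 : ∀ t ≤ -τ, g t = 0) :
    ∃ f : ℝ → EuclideanSpace ℂ (Fin n), StronglyMeasurable f ∧ L2LocLine f ∧
      (∀ t ≤ 0, f t = g t) ∧ ∀ t, f t = A.toEuclideanLin (f (t - τ)) + g t := by
  let S : ℕ → ℝ → EuclideanSpace ℂ (Fin n) := fun N t =>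
    ∑ k ∈ Finset.range N, (A ^ k).toEuclideanLin (g (t - k * τ))
  let N : ℝ → ℕ := fun t => ⌈t / τ⌉₊ + 1
  have hstab : ∀ t M, N t ≤ M → S M t = S (N t) t := by
    intro t M hM
    refine (Finset.sum_subset (Finset.range_mono hM) fun k _ hk => ?_).symm
    have h1 : ⌈t / τ⌉₊ + 1 ≤ k := not_lt.1 fun h => hk (Finset.mem_range.2 h)
    have h2 : t / τ + 1 ≤ k := by
      have h3 : ((⌈t / τ⌉₊ : ℝ)) + 1 ≤ k := by exact_mod_cast h1
      linarith [Nat.le_ceil (t / τ)]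
    have h3 : t + τ ≤ k * τ := by
      rw [← div_le_iff₀ hτ, add_div, div_self hτ.ne']; exact h2
    rw [hg0 _ (by linarith), map_zero]
  have hSm : ∀ M, StronglyMeasurable (S M) := fun M =>
    Finset.stronglyMeasurable_fun_sum _ fun k _ =>
      (A ^ k).continuous_toEuclideanLin.comp_stronglyMeasurable
        (hg.comp_measurable (measurable_id.sub_const _))
  have hS2 : ∀ M, L2LocLine (S M) := fun M a b =>
    memLp_finsetSum _ fun k _ =>
      (LinearMap.toContinuousLinearMap (A ^ k).toEuclideanLin).comp_memLp' (hg2.comp_sub _ a b)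
  refine ⟨fun t => S (N t) t, ?_, fun a b => ?_, fun t ht => ?_, fun t => ?_⟩
  · refine stronglyMeasurable_of_tendsto Filter.atTop hSm (tendsto_pi_nhds.2 fun t => ?_)
    refine tendsto_const_nhds.congr' ?_
    filter_upwards [Filter.eventually_ge_atTop (N t)] with M hM
    exact (hstab t M hM).symm
  · refine (hS2 (N b) a b).ae_eq ?_
    filter_upwards [ae_restrict_mem measurableSet_Ioc] with t ht
    refine hstab t (N b) ?_
    exact Nat.add_le_add_right (Nat.ceil_mono (by gcongr; exact ht.2)) 1
  · have h1 : N t = 1 := by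
      simp only [N]
      rw [Nat.ceil_eq_zero.2 (div_nonpos_of_nonpos_of_nonneg ht hτ.le)]
    simp [S, h1]
  · have h1 := hstab t (N t + N (t - τ) + 1) (by omega)
    have h2 := hstab (t - τ) (N t + N (t - τ)) (by omega)
    simp only [← h1, ← h2]
    simp only [S]
    rw [Finset.sum_range_succ', map_sum]
    congr 1
    · refine Finset.sum_congr rfl fun k _ => ?_
      rw [Matrix.toEuclideanLin_pow_succ_apply]
      congr 3
      push_cast
      ring
    · simp

/-- For every `L²_loc` inflow law `w₀ = A w₁ + g` the transport equation has a solution. -/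
theorem exists_isTransportSolution_of_feedback (r : Slowness)
    (hlam : ∀ᵐ ζ ∂spaceMeasure, lam ζ * r.rho ζ = 1) (A : Matrix (Fin n) (Fin n) ℂ)
    {g : ℝ → EuclideanSpace ℂ (Fin n)} (hg : L2Loc g) (z₀ : StateSpace n) :
    ∃ z w₀ w₁, IsTransportSolution lam z₀ z w₀ w₁ ∧
      ∀ᵐ t ∂(volume.restrict (Ioi (0 : ℝ))), w₀ t = A.toEuclideanLin (w₁ t) + g t := by
  obtain ⟨g', hgm, hg2, hhist, hgg'⟩ := r.exists_boundaryFunction z₀ hg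
  have hg0 : ∀ t ≤ -r.tau, g' t = 0 := fun t ht => by
    rw [hhist t (by linarith [r.tau_pos]), Slowness.history,
      indicator_of_notMem fun h => not_lt.2 ht h.1]
  obtain ⟨f, hf, hf2, hf0, hfeq⟩ := exists_delay_solution r.tau_pos A hgm hg2 hg0
  refine ⟨_, _, _, r.isTransportSolution_of_eq_history hlam hf hf2 fun t ht =>
    (hf0 t ht).trans (hhist t ht), ?_⟩
  filter_upwards [hgg'] with t ht
  rw [hfeq t, ht]

end Feedback

/-! ### The network as a delay system -/

namespace WaveNetwork

variable {n p m : ℕ} (S : WaveNetwork n p m)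

theorem exists_slowness : ∃ r : Slowness, ∀ᵐ ζ ∂spaceMeasure, S.lam ζ * r.rho ζ = 1 := by
  obtain ⟨ε, hε, hlow⟩ := S.lam_pos
  obtain ⟨c, hc⟩ : ∃ c : ℝ, ∀ᵐ s ∂spaceMeasure, ‖S.lam s‖ ≤ c :=
    ⟨(eLpNorm S.lam ∞ spaceMeasure).toReal, by
      filter_upwards [ae_le_eLpNormEssSup (f := S.lam) (μ := spaceMeasure)] with s hs
      rw [← toReal_enorm]
      exact ENNReal.toReal_mono S.lam_memLp.2.ne (by simpa using hs)⟩
  obtain ⟨l, hl, hll⟩ := S.lam_memLp.1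
  have hpos : ∀ s, 0 < max ε (min (l s) (max c ε)) := fun s => hε.trans_le (le_max_left _ _)
  refine ⟨{ rho := fun s => (max ε (min (l s) (max c ε)))⁻¹
            lo := (max c ε)⁻¹
            hi := ε⁻¹
            measurable := (measurable_const.max (hl.measurable.min measurable_const)).inv
            lo_pos := inv_pos.2 (hε.trans_le (le_max_right _ _))
            lo_le := fun s => inv_anti₀ (hpos s) (max_le (le_max_right _ _) (min_le_right _ _))
            le_hi := fun s => inv_anti₀ hε (le_max_left _ _) }, ?_⟩
  filter_upwards [hlow, hc, hll] with s h1 h2 h3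
  have h4 : S.lam s ≤ max c ε := ((le_abs_self _).trans h2).trans (le_max_left _ _)
  rw [← h3, min_eq_left h4, max_eq_right h1, mul_inv_cancel₀ (hε.trans_le h1).ne']

theorem travelTime_eq_tau {r : Slowness} (hr : ∀ᵐ ζ ∂spaceMeasure, S.lam ζ * r.rho ζ = 1) :
    S.travelTime = r.tau := by
  rw [travelTime, Slowness.tau, Slowness.phi, intervalIntegral.integral_of_le zero_le_one,
    intervalIntegral.integral_of_le zero_le_one, ← restrict_Ioo_eq_restrict_Ioc]
  refine integral_congr_ae ?_
  filter_upwards [hr] with ζ hζ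
  exact inv_eq_of_mul_eq_one_right hζ

theorem K_det_isUnit : IsUnit S.K.det := (Matrix.isUnit_iff_isUnit_det _).1 S.K_isUnit

/-- Solving the boundary condition for the inflow. -/
theorem input_iff (u : EuclideanSpace ℂ (Fin p)) (w₀ w₁ : EuclideanSpace ℂ (Fin n)) :
    (inputBlock n p).toEuclideanLin u =
        -(S.K.toEuclideanLin w₀) - (S.L * S.fundamentalMatrix 1).toEuclideanLin w₁ ↔
      w₀ = S.Ad.toEuclideanLin w₁ + S.Bd.toEuclideanLin u := by
  have hKinv : ∀ v : EuclideanSpace ℂ (Fin n),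
      S.K⁻¹.toEuclideanLin (S.K.toEuclideanLin v) = v := fun v => by
    rw [← Matrix.toEuclideanLin_mul_apply, Matrix.nonsing_inv_mul _ S.K_det_isUnit]
    simp
  have hKinv' : ∀ v : EuclideanSpace ℂ (Fin n),
      S.K.toEuclideanLin (S.K⁻¹.toEuclideanLin v) = v := fun v => by
    rw [← Matrix.toEuclideanLin_mul_apply, Matrix.mul_nonsing_inv _ S.K_det_isUnit]
    simp
  have hA : S.Ad.toEuclideanLin w₁ =
      -S.K⁻¹.toEuclideanLin ((S.L * S.fundamentalMatrix 1).toEuclideanLin w₁) := by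
    rw [Ad, map_neg, LinearMap.neg_apply, Matrix.mul_assoc, Matrix.toEuclideanLin_mul_apply]
  have hB : S.Bd.toEuclideanLin u =
      -S.K⁻¹.toEuclideanLin ((inputBlock n p).toEuclideanLin u) := by
    rw [Bd, map_neg, LinearMap.neg_apply, Matrix.toEuclideanLin_mul_apply]
  rw [hA, hB]
  constructor
  · intro h
    rw [h, map_sub, map_neg, hKinv]
    abel
  · intro h
    rw [h, map_add, map_neg, map_neg, hKinv', hKinv']
    abel

theorem output_eq {u : EuclideanSpace ℂ (Fin p)} {w₀ w₁ : EuclideanSpace ℂ (Fin n)}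
    (h : w₀ = S.Ad.toEuclideanLin w₁ + S.Bd.toEuclideanLin u) :
    -(S.Ky.toEuclideanLin w₀) - (S.Ly * S.fundamentalMatrix 1).toEuclideanLin w₁ =
      S.Cd.toEuclideanLin w₁ + S.Dd.toEuclideanLin u := by
  rw [h, Ad, Bd, Cd, Dd]
  simp only [map_add, map_neg, map_sub, LinearMap.neg_apply, LinearMap.sub_apply, Matrix.sub_mul,
    Matrix.toEuclideanLin_mul_apply]
  abel

/-- The network is the discrete-time system `(A_d, B_d, C_d, D_d)` acting between the traces of a
pure transport equation. -/
theorem isSolution_iff {z₀ : StateSpace n} {u : ℝ → EuclideanSpace ℂ (Fin p)}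
    {z : ℝ → StateSpace n} {w₀ w₁ : ℝ → EuclideanSpace ℂ (Fin n)}
    {y : ℝ → EuclideanSpace ℂ (Fin m)} :
    S.IsSolution z₀ u z w₀ w₁ y ↔ IsTransportSolution S.lam z₀ z w₀ w₁ ∧
      (∀ᵐ t ∂(volume.restrict (Ioi (0 : ℝ))),
        w₀ t = S.Ad.toEuclideanLin (w₁ t) + S.Bd.toEuclideanLin (u t)) ∧
      ∀ᵐ t ∂(volume.restrict (Ioi (0 : ℝ))),
        y t = S.Cd.toEuclideanLin (w₁ t) + S.Dd.toEuclideanLin (u t) := by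
  constructor
  · intro h
    have hin : ∀ᵐ t ∂(volume.restrict (Ioi (0 : ℝ))),
        w₀ t = S.Ad.toEuclideanLin (w₁ t) + S.Bd.toEuclideanLin (u t) := by
      filter_upwards [h.input] with t ht
      exact (S.input_iff _ _ _).1 ht
    refine ⟨h.transport, hin, ?_⟩
    filter_upwards [h.output, hin] with t h1 h2
    rw [h1, S.output_eq h2]
  · rintro ⟨h, hin, hout⟩
    refine ⟨h, ?_, ?_⟩
    · filter_upwards [hin] with t ht
      exact (S.input_iff _ _ _).2 ht
    · filter_upwards [hin, hout] with t h1 h2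
      rw [h2, S.output_eq h1]

theorem APi_eq (X : Matrix (Fin n) (Fin n) ℂ) : S.APi X = S.Ad + S.Bd * S.Fd X := by
  rw [APi, Fd, Matrix.mul_neg, ← sub_eq_add_neg, Matrix.mul_assoc]

/-- A solution with feedback input is a solution of the closed-loop system. -/
theorem IsSolution.isClosedLoopSolution {S : WaveNetwork n p m} {F : Matrix (Fin p) (Fin n) ℂ}
    {z₀ : StateSpace n} {u : ℝ → EuclideanSpace ℂ (Fin p)} {z : ℝ → StateSpace n}
    {w₀ w₁ : ℝ → EuclideanSpace ℂ (Fin n)} {y : ℝ → EuclideanSpace ℂ (Fin m)}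
    (h : S.IsSolution z₀ u z w₀ w₁ y)
    (hu : u =ᵐ[volume.restrict (Ioi (0 : ℝ))] fun t => F.toEuclideanLin (w₁ t)) :
    S.IsClosedLoopSolution F z₀ z w₀ w₁ := by
  obtain ⟨ht, hin, -⟩ := S.isSolution_iff.1 h
  refine ⟨ht, ?_⟩
  filter_upwards [hin, hu] with t h1 h2
  rw [h1, h2, map_add, LinearMap.add_apply, Matrix.toEuclideanLin_mul_apply]

theorem IsClosedLoopSolution.isSolution {S : WaveNetwork n p m} {F : Matrix (Fin p) (Fin n) ℂ}
    {z₀ : StateSpace n} {z : ℝ → StateSpace n} {w₀ w₁ : ℝ → EuclideanSpace ℂ (Fin n)}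
    (h : S.IsClosedLoopSolution F z₀ z w₀ w₁) :
    S.IsSolution z₀ (fun t => F.toEuclideanLin (w₁ t)) z w₀ w₁
      (fun t => S.Cd.toEuclideanLin (w₁ t) + S.Dd.toEuclideanLin (F.toEuclideanLin (w₁ t))) := by
  refine S.isSolution_iff.2 ⟨h.transport, ?_, Filter.Eventually.of_forall fun t => rfl⟩
  filter_upwards [h.boundary] with t ht
  rw [ht, map_add, LinearMap.add_apply, Matrix.toEuclideanLin_mul_apply]

theorem exists_unique_solution (z₀ : StateSpace n) {u : ℝ → EuclideanSpace ℂ (Fin p)}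
    (hu : L2Loc u) :
    ∃ z w₀ w₁ y, S.IsSolution z₀ u z w₀ w₁ y ∧
      ∀ z' w₀' w₁' y', S.IsSolution z₀ u z' w₀' w₁' y' →
        EqOn z' z (Ici 0) ∧ w₀' =ᵐ[volume.restrict (Ioi (0 : ℝ))] w₀ ∧
          w₁' =ᵐ[volume.restrict (Ioi (0 : ℝ))] w₁ ∧
          y' =ᵐ[volume.restrict (Ioi (0 : ℝ))] y := by
  obtain ⟨r, hr⟩ := S.exists_slowness
  obtain ⟨z, w₀, w₁, hz, hA⟩ := exists_isTransportSolution_of_feedback r hr S.Ad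
    (hu.toEuclideanLin S.Bd) z₀
  refine ⟨z, w₀, w₁, fun t => S.Cd.toEuclideanLin (w₁ t) + S.Dd.toEuclideanLin (u t),
    S.isSolution_iff.2 ⟨hz, hA, Filter.Eventually.of_forall fun t => rfl⟩, ?_⟩
  intro z' w₀' w₁' y' h'
  obtain ⟨hz', hA', hy'⟩ := S.isSolution_iff.1 h'
  obtain ⟨h1, h2, h3⟩ := hz'.unique_of_feedback r S.lam_memLp hr hz hA' hA
  refine ⟨h1, h2, h3, ?_⟩
  filter_upwards [hy', h3] with t h4 h5
  rw [h4, h5]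

theorem exists_closedLoopSolution (F : Matrix (Fin p) (Fin n) ℂ) (z₀ : StateSpace n) :
    ∃ z w₀ w₁, S.IsClosedLoopSolution F z₀ z w₀ w₁ := by
  obtain ⟨r, hr⟩ := S.exists_slowness
  obtain ⟨z, w₀, w₁, hz, hA⟩ := exists_isTransportSolution_of_feedback r hr (S.Ad + S.Bd * F)
    (g := 0) (fun T => MemLp.zero) z₀
  exact ⟨z, w₀, w₁, hz, by simpa using hA⟩

theorem IsClosedLoopSolution.unique {S : WaveNetwork n p m} {F : Matrix (Fin p) (Fin n) ℂ}
    {z₀ : StateSpace n} {z z' : ℝ → StateSpace n} {w₀ w₁ w₀' w₁' : ℝ → EuclideanSpace ℂ (Fin n)}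
    (h : S.IsClosedLoopSolution F z₀ z w₀ w₁) (h' : S.IsClosedLoopSolution F z₀ z' w₀' w₁') :
    EqOn z z' (Ici 0) ∧ w₀ =ᵐ[volume.restrict (Ioi (0 : ℝ))] w₀' ∧
      w₁ =ᵐ[volume.restrict (Ioi (0 : ℝ))] w₁' := by
  obtain ⟨r, hr⟩ := S.exists_slowness
  exact h.transport.unique_of_feedback r S.lam_memLp hr h'.transport (A := S.Ad + S.Bd * F)
    (g := 0) (h.boundary.mono fun t ht => by rw [ht, Pi.zero_apply, add_zero])
    (h'.boundary.mono fun t ht => by rw [ht, Pi.zero_apply, add_zero])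

/-! ### Optimality of the Riccati feedback -/

/-- Along almost every characteristic fibre `s + kτ`, `k ∈ ℕ`, a solution of the network is a
trajectory of the discrete-time system, started at the flux of the initial state. -/
theorem IsSolution.ae_discrete {S : WaveNetwork n p m} {z₀ : StateSpace n}
    {u : ℝ → EuclideanSpace ℂ (Fin p)} {z : ℝ → StateSpace n}
    {w₀ w₁ : ℝ → EuclideanSpace ℂ (Fin n)} {y : ℝ → EuclideanSpace ℂ (Fin m)}
    (h : S.IsSolution z₀ u z w₀ w₁ y) {r : Slowness}
    (hr : ∀ᵐ ζ ∂spaceMeasure, S.lam ζ * r.rho ζ = 1) :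
    ∀ᵐ s ∂(volume.restrict (Ioc 0 r.tau)),
      w₁ (s + (0 : ℕ) * r.tau) = r.history z₀ (s - r.tau) ∧
      (∀ k : ℕ, w₁ (s + (k + 1 : ℕ) * r.tau) = S.Ad.toEuclideanLin (w₁ (s + k * r.tau)) +
        S.Bd.toEuclideanLin (u (s + k * r.tau))) ∧
      ∀ k : ℕ, y (s + k * r.tau) = S.Cd.toEuclideanLin (w₁ (s + k * r.tau)) +
        S.Dd.toEuclideanLin (u (s + k * r.tau)) := by
  obtain ⟨ht, hin, hout⟩ := S.isSolution_iff.1 h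
  filter_upwards [ht.ae_traces r S.lam_memLp hr, (ae_restrict_Ioi_iff r.tau_pos).1 hin,
    (ae_restrict_Ioi_iff r.tau_pos).1 hout] with s h1 h2 h3
  refine ⟨?_, fun k => ?_, h3⟩
  · rw [← h1.1]; simp
  · rw [h1.2, h2]

/-- The value `∫₀^τ ⟨x₀(s), X x₀(s)⟩ ds` of the optimal control problem, where `x₀` is the flux
carried by the initial state. -/
noncomputable def value (X : Matrix (Fin n) (Fin n) ℂ) (r : Slowness) (z₀ : StateSpace n) : ℝ≥0∞ :=
  ∫⁻ s in Ioc 0 r.tau, ENNReal.ofReal (X.quadForm (r.history z₀ (s - r.tau)))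

theorem value_lt_top (X : Matrix (Fin n) (Fin n) ℂ) (r : Slowness) (z₀ : StateSpace n) :
    value X r z₀ < ∞ := by
  obtain ⟨c, hc, hle⟩ := X.exists_norm_toEuclideanLin_le
  have hq : ∀ x, ENNReal.ofReal (X.quadForm x) ≤ ENNReal.ofReal c * ‖x‖ₑ ^ 2 := by
    intro x
    rw [← ofReal_norm, ← ENNReal.ofReal_pow (norm_nonneg _), ← ENNReal.ofReal_mul hc]
    refine ENNReal.ofReal_le_ofReal ?_
    calc X.quadForm x ≤ ‖inner ℂ x (X.toEuclideanLin x)‖ := Complex.re_le_norm _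
      _ ≤ ‖x‖ * ‖X.toEuclideanLin x‖ := norm_inner_le_norm _ _
      _ ≤ ‖x‖ * (c * ‖x‖) := mul_le_mul_of_nonneg_left (hle x) (norm_nonneg _)
      _ = c * ‖x‖ ^ 2 := by ring
  refine (lintegral_mono fun s => hq _).trans_lt ?_
  rw [lintegral_const_mul' _ _ ENNReal.ofReal_ne_top, r.lintegral_history_shift]
  refine ENNReal.mul_lt_top ENNReal.ofReal_lt_top ?_
  rw [← memLp_two_iff (r.stronglyMeasurable_history z₀).aestronglyMeasurable]
  exact (r.memLp_history z₀).restrict _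

section Optimality

variable {S} {X : Matrix (Fin n) (Fin n) ℂ} {z₀ : StateSpace n}
  {u : ℝ → EuclideanSpace ℂ (Fin p)} {z : ℝ → StateSpace n}
  {w₀ w₁ : ℝ → EuclideanSpace ℂ (Fin n)} {y : ℝ → EuclideanSpace ℂ (Fin m)} {r : Slowness}

theorem IsSolution.aemeasurable_cost (h : S.IsSolution z₀ u z w₀ w₁ y) (hu : L2Loc u) :
    AEMeasurable (fun t => ‖y t‖ₑ ^ 2 + ‖u t‖ₑ ^ 2) (volume.restrict (Ioi (0 : ℝ))) := by
  obtain ⟨ht, -, hout⟩ := S.isSolution_iff.1 h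
  have hy : AEStronglyMeasurable y (volume.restrict (Ioi (0 : ℝ))) :=
    ((S.Cd.continuous_toEuclideanLin.comp_aestronglyMeasurable
      ht.trace_one.aestronglyMeasurable).add (S.Dd.continuous_toEuclideanLin.comp_aestronglyMeasurable
      hu.aestronglyMeasurable)).congr (hout.mono fun t ht => ht.symm)
  exact (hy.enorm.pow_const 2).add (hu.aestronglyMeasurable.enorm.pow_const 2)

theorem IsSolution.value_le (hX : IsCARESolution S.Ad S.Bd S.Cd S.Dd X)
    {L : Matrix (Fin n) (Fin m) ℂ} (hL : spectralRadius ℂ (S.Ad + L * S.Cd) < 1)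
    (h : S.IsSolution z₀ u z w₀ w₁ y) (hu : L2Loc u)
    (hr : ∀ᵐ ζ ∂spaceMeasure, S.lam ζ * r.rho ζ = 1) :
    value X r z₀ ≤ ∫⁻ t in Ioi (0 : ℝ), (‖y t‖ₑ ^ 2 + ‖u t‖ₑ ^ 2) := by
  rw [lintegral_Ioi_eq r.tau_pos (h.aemeasurable_cost hu)]
  refine lintegral_mono_ae ?_
  filter_upwards [h.ae_discrete hr] with s hs
  refine le_trans (ENNReal.ofReal_le_ofReal ?_) (hX.le_tsum_cost hL
    (x := fun k : ℕ => w₁ (s + k * r.tau)) hs.2.1 hs.2.2 0)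
  simp only [hs.1]
  exact le_add_of_nonneg_right ((hX.1.posDef_riccati _ _).posSemidef.quadForm_nonneg _)

theorem IsClosedLoopSolution.lintegral_cost_le (hX : IsCARESolution S.Ad S.Bd S.Cd S.Dd X)
    (h : S.IsClosedLoopSolution (S.Fd X) z₀ z w₀ w₁)
    (hr : ∀ᵐ ζ ∂spaceMeasure, S.lam ζ * r.rho ζ = 1) :
    ∫⁻ t in Ioi (0 : ℝ), (‖S.Cd.toEuclideanLin (w₁ t) +
      S.Dd.toEuclideanLin ((S.Fd X).toEuclideanLin (w₁ t))‖ₑ ^ 2 +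
        ‖(S.Fd X).toEuclideanLin (w₁ t)‖ₑ ^ 2) ≤ value X r z₀ := by
  have hs := h.isSolution
  rw [lintegral_Ioi_eq r.tau_pos
    (hs.aemeasurable_cost (h.transport.trace_one.toEuclideanLin (S.Fd X)))]
  refine lintegral_mono_ae ?_
  filter_upwards [hs.ae_discrete hr] with s hs
  refine (hX.tsum_cost_le (x := fun k : ℕ => w₁ (s + k * r.tau)) hs.2.1 hs.2.2
    fun k => rfl).trans_eq ?_
  simp only [hs.1]

theorem IsSolution.eq_feedback_of_cost_le (hX : IsCARESolution S.Ad S.Bd S.Cd S.Dd X)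
    {L : Matrix (Fin n) (Fin m) ℂ} (hL : spectralRadius ℂ (S.Ad + L * S.Cd) < 1)
    (h : S.IsSolution z₀ u z w₀ w₁ y) (hu : L2Loc u)
    (hr : ∀ᵐ ζ ∂spaceMeasure, S.lam ζ * r.rho ζ = 1)
    (hle : ∫⁻ t in Ioi (0 : ℝ), (‖y t‖ₑ ^ 2 + ‖u t‖ₑ ^ 2) ≤ value X r z₀) :
    u =ᵐ[volume.restrict (Ioi (0 : ℝ))] fun t => (S.Fd X).toEuclideanLin (w₁ t) := by
  have hmeas := h.aemeasurable_cost hu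
  rw [lintegral_Ioi_eq r.tau_pos hmeas] at hle
  have hlow : ∀ᵐ s ∂(volume.restrict (Ioc 0 r.tau)), ∀ j : ℕ,
      ENNReal.ofReal (X.quadForm (r.history z₀ (s - r.tau)) +
        (1 + S.Ddᴴ * S.Dd + S.Bdᴴ * X * S.Bd).quadForm (u (s + j * r.tau) -
          (S.Fd X).toEuclideanLin (w₁ (s + j * r.tau)))) ≤
        ∑' k : ℕ, (‖y (s + k * r.tau)‖ₑ ^ 2 + ‖u (s + k * r.tau)‖ₑ ^ 2) := by
    filter_upwards [h.ae_discrete hr] with s hs j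
    have := hX.le_tsum_cost hL (x := fun k : ℕ => w₁ (s + k * r.tau)) hs.2.1 hs.2.2 j
    simp only [hs.1] at this
    exact this
  have hRnn : ∀ v, 0 ≤ (1 + S.Ddᴴ * S.Dd + S.Bdᴴ * X * S.Bd).quadForm v :=
    (hX.1.posDef_riccati S.Bd S.Dd).posSemidef.quadForm_nonneg
  have hsum_meas : AEMeasurable
      (fun s => ∑' k : ℕ, (‖y (s + k * r.tau)‖ₑ ^ 2 + ‖u (s + k * r.tau)‖ₑ ^ 2))
      (volume.restrict (Ioc 0 r.tau)) := by
    refine AEMeasurable.tsum fun k => ?_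
    rw [restrict_Ioi_eq_sum_map r.tau_pos] at hmeas
    exact (hmeas.mono_measure (Measure.le_sum _ k)).comp_measurable (measurable_add_const _)
  have heq := ae_eq_of_ae_le_of_lintegral_le
    (f := fun s => ENNReal.ofReal (X.quadForm (r.history z₀ (s - r.tau))))
    (by
      filter_upwards [hlow] with s hs
      refine le_trans (ENNReal.ofReal_le_ofReal ?_) (hs 0)
      exact le_add_of_nonneg_right (hRnn _))
    (value_lt_top X r z₀).ne hsum_meas hle
  refine (ae_restrict_Ioi_iff r.tau_pos).2 ?_
  filter_upwards [hlow, heq] with s h1 h2 k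
  have h3 := h1 k
  rw [← h2, ENNReal.ofReal_le_ofReal_iff (hX.1.quadForm_nonneg _)] at h3
  refine sub_eq_zero.1 ((hX.1.posDef_riccati S.Bd S.Dd).eq_zero_of_quadForm_le ?_)
  linarith

end Optimality

theorem L2Loc_of_memLp {k : ℕ} {v : ℝ → EuclideanSpace ℂ (Fin k)}
    (hv : MemLp v 2 (volume.restrict (Ioi (0 : ℝ)))) : L2Loc v := fun _ =>
  hv.mono_measure (Measure.restrict_mono Ioc_subset_Ioi_self le_rfl)

theorem cost_le_cost_iff {u v : ℝ → EuclideanSpace ℂ (Fin p)}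
    {y y' : ℝ → EuclideanSpace ℂ (Fin m)} :
    S.cost u y ≤ S.cost v y' ↔ ∫⁻ t in Ioi (0 : ℝ), (‖y t‖ₑ ^ 2 + ‖u t‖ₑ ^ 2) ≤
      ∫⁻ t in Ioi (0 : ℝ), (‖y' t‖ₑ ^ 2 + ‖v t‖ₑ ^ 2) := by
  obtain ⟨r, hr⟩ := S.exists_slowness
  have hpos : 0 < S.travelTime⁻¹ := by
    rw [S.travelTime_eq_tau hr]
    exact inv_pos.2 r.tau_pos
  exact ENNReal.mul_le_mul_iff_right (by simpa using hpos) ENNReal.ofReal_ne_top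

/-- The feedback built from a Riccati solution is the unique optimal control, as soon as the
network is detectable. -/
theorem IsClosedLoopSolution.isOptimalControl {S : WaveNetwork n p m}
    {X : Matrix (Fin n) (Fin n) ℂ} (hX : IsCARESolution S.Ad S.Bd S.Cd S.Dd X)
    {L : Matrix (Fin n) (Fin m) ℂ} (hL : spectralRadius ℂ (S.Ad + L * S.Cd) < 1)
    {z₀ : StateSpace n} {z : ℝ → StateSpace n} {w₀ w₁ : ℝ → EuclideanSpace ℂ (Fin n)}
    (h : S.IsClosedLoopSolution (S.Fd X) z₀ z w₀ w₁) :
    S.IsOptimalControl z₀ (fun t => (S.Fd X).toEuclideanLin (w₁ t)) ∧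
      ∀ u, S.IsOptimalControl z₀ u →
        u =ᵐ[volume.restrict (Ioi (0 : ℝ))] fun t => (S.Fd X).toEuclideanLin (w₁ t) := by
  obtain ⟨r, hr⟩ := S.exists_slowness
  have hcost := h.lintegral_cost_le hX hr
  have hmem : MemLp (fun t => (S.Fd X).toEuclideanLin (w₁ t)) 2
      (volume.restrict (Ioi (0 : ℝ))) := by
    rw [memLp_two_iff
      (h.transport.trace_one.toEuclideanLin (S.Fd X)).aestronglyMeasurable]
    refine lt_of_le_of_lt (lintegral_mono fun t => ?_) (hcost.trans_lt (value_lt_top X r z₀))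
    exact le_add_of_nonneg_left zero_le
  refine ⟨⟨hmem, _, ⟨z, w₀, w₁, h.isSolution⟩, fun v hv y' ⟨z', w₀', w₁', h'⟩ => ?_⟩, ?_⟩
  · rw [cost_le_cost_iff]
    exact hcost.trans (h'.value_le hX hL (L2Loc_of_memLp hv) hr)
  · rintro u ⟨hu, y, ⟨z', w₀', w₁', h'⟩, hmin⟩
    have hle := (S.cost_le_cost_iff).1 (hmin _ hmem _ ⟨z, w₀, w₁, h.isSolution⟩)
    have hfb := h'.eq_feedback_of_cost_le hX hL (L2Loc_of_memLp hu) hr (hle.trans hcost)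
    obtain ⟨-, -, hw⟩ := (h'.isClosedLoopSolution hfb).unique h
    filter_upwards [hfb, hw] with t h1 h2
    rw [h1, h2]

/-! ### Exponential stability of the closed loop -/

/-- If the closed-loop matrix has spectral radius below one, the closed-loop system is
exponentially stable: the state at time `t` consists of the fluxes that have passed the boundary
about `t / τ` times, each passage multiplying by the closed-loop matrix. -/
theorem exponentially_stable (F : Matrix (Fin p) (Fin n) ℂ)
    (hF : spectralRadius ℂ (S.Ad + S.Bd * F) < 1) :
    ∃ C ω : ℝ, 0 < C ∧ 0 < ω ∧
      ∀ (z₀ : StateSpace n) (z : ℝ → StateSpace n) (w₀ w₁ : ℝ → EuclideanSpace ℂ (Fin n)),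
        S.IsClosedLoopSolution F z₀ z w₀ w₁ →
          ∀ t : ℝ, 0 ≤ t → ‖z t‖ ≤ C * Real.exp (-(ω * t)) * ‖z₀‖ := by
  obtain ⟨r, hr⟩ := S.exists_slowness
  obtain ⟨c, q, hc, hq, hq1, hdecay⟩ := Matrix.exists_norm_pow_le_of_spectralRadius_lt_one hF
  set T := S.Ad + S.Bd * F with hT
  have hτ := r.tau_pos
  have hlogq : Real.log q < 0 := Real.log_neg hq hq1
  refine ⟨√(2 * r.hi / r.lo) * c * q⁻¹, -Real.log q / r.tau, ?_, ?_, ?_⟩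
  · have := div_pos (mul_pos two_pos r.hi_pos) r.lo_pos
    positivity
  · exact div_pos (neg_pos.2 hlogq) hτ
  intro z₀ z w₀ w₁ h t ht
  obtain ⟨f, hf, hf2, hhist, hfw, hzs, -⟩ := h.transport.exists_eq_state r S.lam_memLp hr
  -- The values of `f` on the period `((k - 1)τ, kτ]`.
  have hfib : ∀ᵐ s ∂(volume.restrict (Ioc 0 r.tau)), ∀ k : ℕ,
      f (s + k * r.tau - r.tau) = (T ^ k).toEuclideanLin (r.history z₀ (s - r.tau)) := by
    filter_upwards [h.transport.ae_traces r S.lam_memLp hr,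
      (ae_restrict_Ioi_iff r.tau_pos).1 h.boundary, (ae_restrict_Ioi_iff r.tau_pos).1 hfw,
      ae_restrict_mem measurableSet_Ioc] with s h1 h2 h3 hs k
    have hw : ∀ k : ℕ, w₁ (s + k * r.tau) =
        (T ^ k).toEuclideanLin (r.history z₀ (s - r.tau)) := by
      intro k
      induction k with
      | zero => simpa using h1.1
      | succ k ih => rw [h1.2, h2, ih, Matrix.toEuclideanLin_pow_succ_apply]
    cases k with
    | zero =>
      simp only [Nat.cast_zero, zero_mul, add_zero, pow_zero]
      rw [hhist _ (by linarith [hs.2])]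
      simp
    | succ k =>
      have h4 : s + ((k + 1 : ℕ) : ℝ) * r.tau - r.tau = s + k * r.tau := by push_cast; ring
      rw [h4, h3, ← h1.2, hw]
  set H : ℝ≥0∞ := ∫⁻ s in Ioc 0 r.tau, ‖r.history z₀ (s - r.tau)‖ₑ ^ 2 with hH
  have hperiod : ∀ k : ℕ, ∫⁻ s in Ioc (k * r.tau - r.tau) (k * r.tau), ‖f s‖ₑ ^ 2 ≤
      ENNReal.ofReal (c * q ^ k) ^ 2 * H := by
    intro k
    have hmp := measurePreserving_sub_restrict_Ioc (r.tau - k * r.tau) (k * r.tau - r.tau)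
      (k * r.tau)
    rw [show (k : ℝ) * r.tau - r.tau + (r.tau - k * r.tau) = 0 by ring,
      show (k : ℝ) * r.tau + (r.tau - k * r.tau) = r.tau by ring] at hmp
    rw [← hmp.lintegral_comp (f := fun s => ‖f s‖ₑ ^ 2) (hf.enorm.pow_const 2), hH,
      ← lintegral_const_mul' _ _ (ENNReal.pow_ne_top ENNReal.ofReal_ne_top)]
    refine lintegral_mono_ae ?_
    filter_upwards [hfib] with s hs
    rw [show s - (r.tau - (k : ℝ) * r.tau) = s + k * r.tau - r.tau by ring, hs k, ← mul_pow]
    gcongr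
    rw [← ofReal_norm, ← ofReal_norm, ← ENNReal.ofReal_mul (by positivity)]
    exact ENNReal.ofReal_le_ofReal (hdecay k _)
  set k := ⌊t / r.tau⌋₊ with hk
  have hk1 : (k : ℝ) * r.tau ≤ t := by
    rw [← le_div_iff₀ hτ]; exact Nat.floor_le (div_nonneg ht hτ.le)
  have hk2 : t < ((k + 1 : ℕ) : ℝ) * r.tau := by
    rw [← div_lt_iff₀ hτ]; push_cast; exact Nat.lt_floor_add_one _
  have hcover : Ioc (t - r.tau) t ⊆ Ioc (k * r.tau - r.tau) (k * r.tau) ∪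
      Ioc (((k + 1 : ℕ) : ℝ) * r.tau - r.tau) (((k + 1 : ℕ) : ℝ) * r.tau) := by
    intro s hs
    push_cast at hk2 ⊢
    rcases le_or_gt s (k * r.tau) with h1 | h1
    · exact Or.inl ⟨by linarith [hs.1], h1⟩
    · exact Or.inr ⟨by linarith, by linarith [hs.2]⟩
  have hint : ∫⁻ s in Ioc (t - r.tau) t, ‖f s‖ₑ ^ 2 ≤
      2 * (ENNReal.ofReal (c * q ^ k) ^ 2 * H) := by
    refine (lintegral_mono_set hcover).trans ((lintegral_union_le _ _ _).trans ?_)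
    rw [two_mul]
    refine add_le_add (hperiod k) ((hperiod (k + 1)).trans ?_)
    gcongr ENNReal.ofReal (c * ?_) ^ 2 * H
    exact pow_le_pow_of_le_one hq.le hq1.le (Nat.le_succ k)
  have hHle : ENNReal.ofReal r.lo * H ≤ ‖z₀‖ₑ ^ 2 := by
    rw [hH, r.lintegral_history_shift]
    exact r.lintegral_history_le z₀
  have hHtop : H ≠ ∞ := by
    intro htop
    rw [htop, ENNReal.mul_top (by simpa using r.lo_pos)] at hHle
    exact absurd hHle (not_le.2 (ENNReal.pow_lt_top enorm_lt_top))
  have hHreal : r.lo * H.toReal ≤ ‖z₀‖ ^ 2 := by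
    have := ENNReal.toReal_mono (ENNReal.pow_lt_top enorm_lt_top).ne hHle
    rwa [ENNReal.toReal_mul, ENNReal.toReal_ofReal r.lo_pos.le, ENNReal.toReal_pow,
      toReal_enorm] at this
  have hzt : ‖z t‖ₑ ^ 2 ≤ ENNReal.ofReal r.hi * (2 * (ENNReal.ofReal (c * q ^ k) ^ 2 * H)) := by
    rw [hzs (mem_Ici.2 ht), r.enorm_state_sq]
    exact (r.lintegral_wave_le hf t).trans (mul_le_mul_right hint _)
  have hztr : ‖z t‖ ^ 2 ≤ r.hi * (2 * ((c * q ^ k) ^ 2 * H.toReal)) := by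
    have := ENNReal.toReal_mono (by finiteness) hzt
    rwa [ENNReal.toReal_mul, ENNReal.toReal_mul, ENNReal.toReal_mul, ENNReal.toReal_pow,
      ENNReal.toReal_pow, ENNReal.toReal_ofReal r.hi_pos.le, toReal_enorm,
      ENNReal.toReal_ofReal (by positivity), ENNReal.toReal_ofNat] at this
  have hqk : q ^ k ≤ q⁻¹ * Real.exp (-(-Real.log q / r.tau * t)) := by
    have h1 : t / r.tau < k + 1 := Nat.lt_floor_add_one _
    have h2 : q ^ k = Real.exp (Real.log q * k) := by
      rw [mul_comm, Real.exp_nat_mul, Real.exp_log hq]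
    have h3 : q⁻¹ = Real.exp (-Real.log q) := by rw [Real.exp_neg, Real.exp_log hq]
    rw [h2, h3, ← Real.exp_add, Real.exp_le_exp]
    have h4 : -(-Real.log q / r.tau * t) = Real.log q * (t / r.tau) := by ring
    rw [h4]
    nlinarith
  have hfin : ‖z t‖ ≤ √(2 * r.hi / r.lo) * (c * q ^ k) * ‖z₀‖ := by
    refine (pow_le_pow_iff_left₀ (norm_nonneg _) (by positivity) two_ne_zero).1 ?_
    have hnn : 0 ≤ 2 * r.hi / r.lo := (div_pos (mul_pos two_pos r.hi_pos) r.lo_pos).le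
    rw [mul_pow, mul_pow, Real.sq_sqrt hnn]
    have hH2 : H.toReal ≤ ‖z₀‖ ^ 2 / r.lo := by
      rw [le_div_iff₀ r.lo_pos, mul_comm]; exact hHreal
    calc ‖z t‖ ^ 2 ≤ r.hi * (2 * ((c * q ^ k) ^ 2 * H.toReal)) := hztr
      _ ≤ r.hi * (2 * ((c * q ^ k) ^ 2 * (‖z₀‖ ^ 2 / r.lo))) := by
          have := r.hi_pos
          gcongr
      _ = 2 * r.hi / r.lo * (c * q ^ k) ^ 2 * ‖z₀‖ ^ 2 := by ring
  calc ‖z t‖ ≤ √(2 * r.hi / r.lo) * (c * q ^ k) * ‖z₀‖ := hfin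
    _ ≤ √(2 * r.hi / r.lo) * (c * (q⁻¹ * Real.exp (-(-Real.log q / r.tau * t)))) * ‖z₀‖ := by
        gcongr
    _ = _ := by ring

end WaveNetwork

theorem theorem3 {n p m : ℕ} (S : WaveNetwork n p m)
    (Pi₁ Pi₂ : Matrix (Fin n) (Fin n) ℂ)
    (hCARE : IsCARESolution S.Ad S.Bd S.Cd S.Dd Pi₁)
    (hFARE : IsFARESolution S.Ad S.Bd S.Cd S.Dd Pi₂)
    (hstable : spectralRadius ℂ (S.APi Pi₁) < 1) :
    -- the open-loop system is well-posed, so that the cost is a function of `z₀` and `u`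
    (∀ (z₀ : StateSpace n) (u : ℝ → EuclideanSpace ℂ (Fin p)), L2Loc u →
      ∃ z w₀ w₁ y, S.IsSolution z₀ u z w₀ w₁ y ∧
        ∀ z' w₀' w₁' y', S.IsSolution z₀ u z' w₀' w₁' y' →
          EqOn z' z (Ici 0) ∧ w₀' =ᵐ[volume.restrict (Ioi (0 : ℝ))] w₀ ∧
            w₁' =ᵐ[volume.restrict (Ioi (0 : ℝ))] w₁ ∧
            y' =ᵐ[volume.restrict (Ioi (0 : ℝ))] y) ∧
    -- the closed-loop system has exactly one solution, and it generates the unique optimal control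
    (∀ z₀ : StateSpace n, ∃ (zopt : ℝ → StateSpace n) (w₀ w₁ : ℝ → EuclideanSpace ℂ (Fin n)),
      S.IsClosedLoopSolution (S.Fd Pi₁) z₀ zopt w₀ w₁ ∧
      (∀ z' w₀' w₁', S.IsClosedLoopSolution (S.Fd Pi₁) z₀ z' w₀' w₁' →
        EqOn z' zopt (Ici 0) ∧ w₀' =ᵐ[volume.restrict (Ioi (0 : ℝ))] w₀ ∧
          w₁' =ᵐ[volume.restrict (Ioi (0 : ℝ))] w₁) ∧
      (∃ y, S.IsSolution z₀ (fun t => (S.Fd Pi₁).toEuclideanLin (w₁ t)) zopt w₀ w₁ y) ∧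
      S.IsOptimalControl z₀ (fun t => (S.Fd Pi₁).toEuclideanLin (w₁ t)) ∧
      (∀ u, S.IsOptimalControl z₀ u →
        u =ᵐ[volume.restrict (Ioi (0 : ℝ))] fun t => (S.Fd Pi₁).toEuclideanLin (w₁ t))) ∧
    -- the closed-loop system is exponentially stable
    (∃ C ω : ℝ, 0 < C ∧ 0 < ω ∧
      ∀ (z₀ : StateSpace n) (z : ℝ → StateSpace n) (w₀ w₁ : ℝ → EuclideanSpace ℂ (Fin n)),
        S.IsClosedLoopSolution (S.Fd Pi₁) z₀ z w₀ w₁ →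
          ∀ t : ℝ, 0 ≤ t → ‖z t‖ ≤ C * Real.exp (-(ω * t)) * ‖z₀‖) := by
  have hAPi : spectralRadius ℂ (S.Ad + S.Bd * S.Fd Pi₁) < 1 := by rwa [← S.APi_eq]
  have hdet := hFARE.spectralRadius_outputInjection_lt_one hAPi
  refine ⟨fun z₀ u hu => S.exists_unique_solution z₀ hu, fun z₀ => ?_,
    S.exponentially_stable _ hAPi⟩
  obtain ⟨z, w₀, w₁, h⟩ := S.exists_closedLoopSolution (S.Fd Pi₁) z₀
  exact ⟨z, w₀, w₁, h, fun z' w₀' w₁' h' => h'.unique h, ⟨_, h.isSolution⟩,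
    h.isOptimalControl hCARE hdet⟩
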